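/- Consider a mechanical system $\dot q=v$, $\dot v=M(q)^{-1}\bigl(-C(q,v)v-\tau_g(q)+u\bigr)$ with $q$ in an open set $\mathcal M\subseteq\mathbb R^n$, $v,u\in\mathbb R^n$, $x=(q,v)$, written $\dot x=f(x)+g(x)u$. Here $M$ is $C^1$ with symmetric positive-definite values, $C$ and $\tau_g$ are locally Lipschitz, and $C$ is a Coriolis and centrifugal matrix of $M$, i.e. $C(q,v)v=\dot M v-\tfrac12\nabla_q\bigl(v^TM(q)v\bigr)$ with $\dot M=\sum_k v_k\,\partial M/\partial q_k$. Let $K_p,K_d$ be symmetric positive definite, $k(x)=\tau_g(q)-K_pq-K_dv$, $V(x)=\tfrac12v^TM(q)v+\tfrac12q^TK_pq$, and, for a given $\nu>0$, $\Gamma_\nu=\{x\in\mathcal M\times\mathbb R^n:V(x)\le\nu\}$ and $\mathcal P_\nu=\{q\in\mathcal M:\tfrac12q^TK_pq\le\nu\}$. Let $c:\mathcal M\to\mathbb R$ be $C^2$ with locally Lipschitz Hessian, $\phi$ a $C^1$ extended class-$\mathcal K$ function, $\alpha$ a locally Lipschitz extended class-$\mathcal K$ function (extended class-$\mathcal K$: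 continuous and strictly increasing $\mathbb R\to\mathbb R$, zero at $0$). Put $\dot c(x)=\nabla c(q)^Tv$, $h(x)=\dot c(x)+\phi(c(q))$, $\mathcal Q=\{q\in\mathcal M:c(q)\ge0\}$, $\mathcal C=\{x=(q,v):q\in\mathcal Q,\ h(x)\ge0\}$, and $z=L_fh+L_gh\,k+\alpha(h)$. Let $\mathcal E$ be an open set with $\mathcal C\subseteq\mathcal E\subseteq\mathcal M\times\mathbb R^n$ such that either $L_gh\ne0$ on $\mathcal E$, or every $x\in\mathcal E$ with $L_gh(x)=0$ satisfies $x\in\operatorname{Int}\mathcal C$ and $\nabla h(x)=0$. Assume that $\mathcal P_\nu\cap\mathcal Q$ is compact and that $k_c>0$ satisfies $\|C(q,v)\|_2\le k_c\|v\|_2$ for $q\in\mathcal P_\nu\cap\mathcal Q$, $v\in\mathbb R^n$. Suppose that $$\psi(q):=-\nabla c^TM(q)^{-1}K_pq+\alpha(\phi(c(q)))>0\quad\text{for all }q\in\mathcal P_\nu\cap\mathcal Q,$$ and, with $\eta_1(q)=\|\nabla c^TM(q)^{-1}K_d\|_2$ and $\eta_2(q)=k_c\|\nabla c^TM(q)^{-1}\|_2+\|\nabla^2c(q)\|_2$,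 that the maximum $$\rho=\max_{q\in\mathcal P_\nu\cap\mathcal Q}\frac{\eta_1(q)+\sqrt{\eta_1(q)^2+4\psi(q)\eta_2(q)}}{2\psi(q)}$$ exists (in particular $\mathcal P_\nu\cap\mathcal Q\neq\emptyset$). With $\|\nabla c\|_{M^{-1}}^2=\nabla c^TM(q)^{-1}\nabla c$ and $\bar u=k-\frac{z}{\|\nabla c\|_{M^{-1}}^2}\nabla c$, consider the controller $$u^*(x)=\begin{cases}k,&z\ge0,\\ \bar u,&z<0,\ \dot c\le0,\\ \bar u+\dfrac{\rho^2z\dot c}{\|\nabla c\|_{M^{-1}}^2}\,v,&z<0,\ \dot c>0.\end{cases}$$ Then for the closed loop $\dot x=f(x)+g(x)u^*(x)$: 1. For every $x_0\in\Gamma_\nu\cap\mathcal C$ a solution with $x(0)=x_0$ exists on $[0,\infty)$, every solution on an interval $[0,T)$ with $x(0)=x_0$ extends to such a one, and every solution on $[0,\infty)$ with $x(0)=x_0$ satisfies $x(t)\in\Gamma_\nu\cap\mathcal C$ and $q(t)\in\mathcal P_\nu\cap\mathcal Q$ for all $t\ge0$. 2. The origin is an asymptotically stable equilibrium, and every solution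 on $[0,\infty)$ starting in $\Gamma_\nu\cap\mathcal C$ converges to it. 3. The closed loop is passive on $\Gamma_\nu\cap\mathcal C$ from the input term $\mu=-K_dv$ to the output $v$, with storage function $V$: on $\Gamma_\nu\cap\mathcal C$ the derivative of $V$ along the closed loop is at most $(-K_dv)^Tv$, and, more generally, along $\dot x=f(x)+g(x)\bigl(u^*(x)+K_dv+\mu\bigr)$ it is at most $\mu^Tv$ for every $\mu\in\mathbb R^n$. -/

import Mathlib

open Set Filter Topology

noncomputable section

/-! ### General notions -/

/-- Extended class-`𝒦` functions: continuous, strictly increasing, vanishing at `0`. -/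
structure IsExtendedClassK (a : ℝ → ℝ) : Prop where
  continuous : Continuous a
  strictMono : StrictMono a
  map_zero : a 0 = 0

/-- `x` solves the autonomous equation `ẋ = F x` on the time set `I`, inside the state space `D`
(derivatives at end points of `I` that belong to `I` are one-sided). -/
def SolvesOn {X : Type*} [NormedAddCommGroup X] [NormedSpace ℝ X]
    (D : Set X) (F : X → X) (x : ℝ → X) (I : Set ℝ) : Prop :=
  (∀ t ∈ I, x t ∈ D) ∧ IsIntegralCurveOn x (fun _ => F) I

/-- From every initial point in `K` there is a solution for all `t ≥ 0`, and every such solution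
converges to the origin. -/
def AttractedToOrigin {X : Type*} [NormedAddCommGroup X] [NormedSpace ℝ X]
    (D : Set X) (F : X → X) (K : Set X) : Prop :=
  ∀ x₀ ∈ K, (∃ x : ℝ → X, SolvesOn D F x (Ici 0) ∧ x 0 = x₀) ∧
    ∀ x : ℝ → X, SolvesOn D F x (Ici 0) → x 0 = x₀ → Tendsto x atTop (𝓝 0)

/-- The origin is an asymptotically stable equilibrium of `ẋ = F x` on `D`: it is an equilibrium,
it is Lyapunov stable, and it is locally attractive. -/
structure AsymptoticallyStableAtOrigin {X : Type*} [NormedAddCommGroup X] [NormedSpace ℝ X]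
    (D : Set X) (F : X → X) : Prop where
  zero_mem : (0 : X) ∈ interior D
  equilibrium : F 0 = 0
  stable : ∀ ε > 0, ∃ δ > 0, ∀ (x : ℝ → X) (T : ℝ), 0 < T → SolvesOn D F x (Ico 0 T) →
    ‖x 0‖ < δ → ∀ t ∈ Ico 0 T, ‖x t‖ < ε
  attractive : ∃ δ > 0, AttractedToOrigin D F (Metric.ball 0 δ)

/-- The system `ẋ = F x μ` with input `μ` and output `y x` is passive on `K ⊆ D` with storage
function `V`: `V` is continuously differentiable, positive semidefinite, and
`∇V(x) · F(x, μ) ≤ ⟨μ, y(x)⟩` for all `x ∈ K` and all inputs `μ`. -/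
structure PassiveOnWithStorage {X U : Type*} [NormedAddCommGroup X] [NormedSpace ℝ X]
    [NormedAddCommGroup U] [InnerProductSpace ℝ U]
    (D K : Set X) (F : X → U → X) (y : X → U) (V : X → ℝ) : Prop where
  contDiffOn : ContDiffOn ℝ 1 V D
  map_zero : V 0 = 0
  nonneg : ∀ x ∈ K, 0 ≤ V x
  dissipation : ∀ x ∈ K, ∀ μ : U, fderiv ℝ V x (F x μ) ≤ inner ℝ μ (y x)

/-- Regularity of a candidate barrier function `h` with safe set `C`, input directional derivative
`Lgh = L_g h`, on `S ∩ E`: either `L_g h` does not vanish there, or it vanishes only at interior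
points of `C` (lying in `S`) at which also `∇h = 0`. -/
def BarrierRegular {X U : Type*} [NormedAddCommGroup X] [NormedSpace ℝ X]
    [NormedAddCommGroup U] [NormedSpace ℝ U]
    (h : X → ℝ) (Lgh : X → U →L[ℝ] ℝ) (C E S : Set X) : Prop :=
  (∀ x ∈ S ∩ E, Lgh x ≠ 0) ∨
    (∀ x ∈ S ∩ E, Lgh x = 0 → x ∈ S ∩ interior C ∧ fderiv ℝ h x = 0)

/-! ### Mechanical systems -/

/-- `ℝⁿ` with the Euclidean norm. -/
abbrev Vec (n : ℕ) : Type := EuclideanSpace ℝ (Fin n)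

/-- Real `n × n` matrices, as operators on Euclidean space; the norm is the spectral norm. -/
abbrev Mat (n : ℕ) : Type := Vec n →L[ℝ] Vec n

/-- Symmetric positive-definite matrices. -/
structure SymPosDef {n : ℕ} (A : Mat n) : Prop where
  symm : ∀ v w : Vec n, inner ℝ (A v) w = inner ℝ v (A w)
  pos : ∀ v : Vec n, v ≠ 0 → 0 < inner ℝ v (A v)

/-- A mechanical system `q̇ = v`, `M(q) v̇ = -C(q,v) v - τ_g(q) + u` with configurations in an open
set `Q₀ ⊆ ℝⁿ`. The Coriolis and centrifugal matrix is any matrix function for which `C(q,v) v` is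
the velocity-quadratic force of the Euler-Lagrange equations of the kinetic energy
`½ vᵀ M(q) v`, that is, `C(q,v) v = Ṁ v - ½ ∇_q (vᵀ M(q) v)`. -/
structure MechanicalSystem (n : ℕ) where
  /-- configuration space -/
  Q₀ : Set (Vec n)
  isOpen_Q₀ : IsOpen Q₀
  /-- inertia matrix -/
  M : Vec n → Mat n
  /-- Coriolis and centrifugal matrix -/
  C : Vec n → Vec n → Mat n
  /-- generalized gravity -/
  τg : Vec n → Vec n
  M_contDiffOn : ContDiffOn ℝ 1 M Q₀
  M_posDef : ∀ q ∈ Q₀, SymPosDef (M q)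
  C_lipschitz : LocallyLipschitzOn (Q₀ ×ˢ univ) (fun x : Vec n × Vec n => C x.1 x.2)
  C_coriolis : ∀ q ∈ Q₀, ∀ v w : Vec n,
    inner ℝ (C q v v) w
      = inner ℝ (fderiv ℝ M q v v) w - (1 / 2) * inner ℝ (fderiv ℝ M q w v) v
  τg_lipschitz : LocallyLipschitzOn Q₀ τg

namespace MechanicalSystem

variable {n : ℕ} (S : MechanicalSystem n)

/-- The state space `Q₀ × ℝⁿ` of pairs `x = (q, v)`. -/
def stateSpace : Set (Vec n × Vec n) := S.Q₀ ×ˢ univ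

/-- `M(q)⁻¹`. -/
def Minv (q : Vec n) : Mat n := (S.M q).inverse

/-- Drift vector field `f` of `ẋ = f(x) + g(x) u`. -/
def drift (x : Vec n × Vec n) : Vec n × Vec n :=
  (x.2, S.Minv x.1 (-(S.C x.1 x.2 x.2) - S.τg x.1))

/-- Input matrix `g(x) = (0, M(q)⁻¹)` of `ẋ = f(x) + g(x) u`. -/
def inputMap (x : Vec n × Vec n) : Vec n →L[ℝ] Vec n × Vec n :=
  (ContinuousLinearMap.inr ℝ (Vec n) (Vec n)).comp (S.Minv x.1)

/-- `L_f h`. -/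
def lieDrift (h : Vec n × Vec n → ℝ) (x : Vec n × Vec n) : ℝ := fderiv ℝ h x (S.drift x)

/-- `L_g h`, a row vector. -/
def lieInput (h : Vec n × Vec n → ℝ) (x : Vec n × Vec n) : Vec n →L[ℝ] ℝ :=
  (fderiv ℝ h x).comp (S.inputMap x)

end MechanicalSystem

/-- Design data: the gains of the nominal controller, the constraint function `c`, and the
functions `φ` and `α` of the barrier condition. -/
structure SafetyDesign {n : ℕ} (S : MechanicalSystem n) where
  /-- proportional gain -/
  Kp : Mat n
  /-- derivative gain -/
  Kd : Mat n
  /-- constraint function -/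
  c : Vec n → ℝ
  φ : ℝ → ℝ
  α : ℝ → ℝ
  Kp_posDef : SymPosDef Kp
  Kd_posDef : SymPosDef Kd
  c_contDiffOn : ContDiffOn ℝ 2 c S.Q₀
  c_hessian_lipschitz : LocallyLipschitzOn S.Q₀ (fderiv ℝ (fderiv ℝ c))
  φ_classK : IsExtendedClassK φ
  φ_contDiff : ContDiff ℝ 1 φ
  α_classK : IsExtendedClassK α
  α_lipschitz : LocallyLipschitz α

namespace SafetyDesign

variable {n : ℕ} {S : MechanicalSystem n} (K : SafetyDesign S)

/-- PD-plus-gravity nominal control `k(x) = τ_g(q) - K_p q - K_d v`. -/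
def nominal (x : Vec n × Vec n) : Vec n := S.τg x.1 - K.Kp x.1 - K.Kd x.2

/-- Lyapunov function `V(x) = ½ vᵀ M(q) v + ½ qᵀ K_p q`. -/
def energy (x : Vec n × Vec n) : ℝ :=
  (1 / 2) * inner ℝ x.2 (S.M x.1 x.2) + (1 / 2) * inner ℝ x.1 (K.Kp x.1)

/-- Sublevel set `Γ_ν` of the Lyapunov function. -/
def Γ (ν : ℝ) : Set (Vec n × Vec n) := {x | x ∈ S.stateSpace ∧ K.energy x ≤ ν}

/-- Sublevel set `P_ν` of the potential function `½ qᵀ K_p q`. -/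
def P (ν : ℝ) : Set (Vec n) := {q | q ∈ S.Q₀ ∧ (1 / 2) * inner ℝ q (K.Kp q) ≤ ν}

/-- Constraint set `Q = {q : c(q) ≥ 0}`. -/
def Q : Set (Vec n) := {q | q ∈ S.Q₀ ∧ 0 ≤ K.c q}

/-- `ċ = ∇c(q)ᵀ v`. -/
def cdot (x : Vec n × Vec n) : ℝ := inner ℝ (gradient K.c x.1) x.2

/-- High-order barrier function `h(x) = ∇c(q)ᵀ v + φ(c(q))`. -/
def h (x : Vec n × Vec n) : ℝ := K.cdot x + K.φ (K.c x.1)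

/-- Safe set `𝒞 = (Q × ℝⁿ) ∩ {h ≥ 0}`. -/
def safeSet : Set (Vec n × Vec n) := {x | x.1 ∈ K.Q ∧ 0 ≤ K.h x}

/-- `z = L_f h + L_g h k + α(h)`. -/
def z (x : Vec n × Vec n) : ℝ :=
  S.lieDrift K.h x + S.lieInput K.h x (K.nominal x) + K.α (K.h x)

/-- `‖∇c‖²_{M⁻¹} = ∇cᵀ M(q)⁻¹ ∇c`. -/
def gradNormSq (q : Vec n) : ℝ := inner ℝ (gradient K.c q) (S.Minv q (gradient K.c q))

/-- `ū = k - z / ‖∇c‖²_{M⁻¹} ∇c`. -/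
def ubar (x : Vec n × Vec n) : Vec n :=
  K.nominal x - (K.z x / K.gradNormSq x.1) • gradient K.c x.1

open Classical in
/-- The augmented control law `u*`. -/
def augControl (ρ : ℝ) (x : Vec n × Vec n) : Vec n :=
  if 0 ≤ K.z x then K.nominal x
  else if K.cdot x ≤ 0 then K.ubar x
  else K.ubar x + (ρ ^ 2 * K.z x * K.cdot x / K.gradNormSq x.1) • x.2

/-- Closed-loop vector field `f(x) + g(x) u*(x)`. -/
def closedLoop (ρ : ℝ) (x : Vec n × Vec n) : Vec n × Vec n :=
  S.drift x + S.inputMap x (K.augControl ρ x)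

/-- The closed loop in which the damping term `-K_d v` of the nominal control, as it enters `u*`
additively, is replaced by an input `μ`; for `μ = -K_d v` this is `closedLoop`. -/
def portedLoop (ρ : ℝ) (x : Vec n × Vec n) (μ : Vec n) : Vec n × Vec n :=
  S.drift x + S.inputMap x (K.augControl ρ x + K.Kd x.2 + μ)

/-- `ψ(q) = -∇cᵀ M(q)⁻¹ K_p q + α(φ(c(q)))`. -/
def ψ (q : Vec n) : ℝ :=
  -inner ℝ (gradient K.c q) (S.Minv q (K.Kp q)) + K.α (K.φ (K.c q))

/-- `‖∇cᵀ M(q)⁻¹ K_d‖₂`. -/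
def η₁ (q : Vec n) : ℝ :=
  ‖((innerSL ℝ (gradient K.c q)).comp (S.Minv q)).comp K.Kd‖

/-- `k_c ‖∇cᵀ M(q)⁻¹‖₂ + ‖∇²c(q)‖₂`. -/
def η₂ (kc : ℝ) (q : Vec n) : ℝ :=
  kc * ‖(innerSL ℝ (gradient K.c q)).comp (S.Minv q)‖ + ‖fderiv ℝ (fderiv ℝ K.c) q‖

/-- The positive root of `ψ r² - η₁ r - η₂ = 0`, whose maximum over `P_ν ∩ Q` is the gain `ρ`. -/
def gainAt (kc : ℝ) (q : Vec n) : ℝ :=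
  (K.η₁ q + √(K.η₁ q ^ 2 + 4 * K.ψ q * K.η₂ kc q)) / (2 * K.ψ q)

end SafetyDesign

end

/-! ### Existence of solutions for continuous vector fields (Peano). -/

section ODE

variable {X : Type*} [NormedAddCommGroup X] [NormedSpace ℝ X]

/-! Write `λ = min z 0 / ‖∇c‖²` (`multiplier`). The three branches of `u*` become the single formula
`k - λ ∇c + ρ² λ max(ċ,0) v`. On `A = Γ_ν ∩ 𝒞`, wherever `∇c = 0` the regularity hypothesis gives `z
= ψ > 0`, so the closed loop is continuous on an open neighbourhood of `A` (`mem_regularRegion`,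
`continuousOn_closedLoop`). The argument uses only this continuity and never uniqueness of
solutions.

Energy: `V̇ = -vᵀK_d v + vᵀ(u* - k)`, and the last term is `-λ (ċ - ρ²‖v‖² max(ċ,0))` with `λ ≤ 0`.
It is nonpositive if `ċ ≤ 0`. If `ċ > 0`, then `z ≥ ψ - η₁‖v‖ - η₂‖v‖²` (`le_z`), so `z < 0` forces
`‖v‖` to be so large that `ρ‖v‖ ≥ 1`. The choice of `ρ` is made for this bound, which also gives
passivity.

Safety: `ḣ = max(z,0) - α(h) + e · max(ċ,0)`, where `e` has no definite sign. Since `ċ = h - φ(c)`,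
having `h < 0` and `ċ > 0` forces `c < 0` and `ċ ≤ L|c|`. Hence `min(c,0)² + min(h,0)²` satisfies a
linear differential inequality and stays zero (`min_zero_mul_deriv_add_le`,
`eventually_mem_safeSet`). With the decay of `V` this makes the compact set `A` forward invariant,
so solutions are global.

Convergence: Barbalat's lemma applied to `V` gives `v → 0`, and applied to `v` it gives `v̇ → 0`.
The vector field thus tends to zero along the solution, and its only zero in `A` is the origin. That
the origin lies in the interior of `A` is itself a consequence of `ψ > 0` (`zero_mem_of_ψ_pos`). -/

theorem norm_sub_sub_smul_le_of_norm_deriv_sub_le {x x' : ℝ → X} {I : Set ℝ} (hI : Convex ℝ I)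
    (hx : ∀ t ∈ I, HasDerivWithinAt x (x' t) I t) {t s C : ℝ} (ht : t ∈ I) (hs : s ∈ I)
    (hC : ∀ r ∈ uIcc t s, ‖x' r - x' t‖ ≤ C) :
    ‖x s - x t - (s - t) • x' t‖ ≤ C * |s - t| := by
  have hsub : uIcc t s ⊆ I := by
    rw [← segment_eq_uIcc]; exact hI.segment_subset ht hs
  have h := (convex_uIcc t s).norm_image_sub_le_of_norm_hasDerivWithin_le
    (f := fun r => x r - r • x' t) (f' := fun r => x' r - x' t) (C := C) (x := t) (y := s)
    (fun r hr => by
      have h1 := ((hx r (hsub hr)).mono hsub).sub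
        (((hasDerivWithinAt_id r (uIcc t s)).smul_const (x' t)))
      rw [one_smul] at h1
      exact h1) hC left_mem_uIcc right_mem_uIcc
  rw [Real.norm_eq_abs] at h
  convert h using 2
  module

/-- A compactly supported continuous vector field on a finite-dimensional space has solutions
for all positive times. -/
theorem exists_isIntegralCurveOn_Ici_of_hasCompactSupport [FiniteDimensional ℝ X] {G : X → X}
    (hG : Continuous G) (hsupp : HasCompactSupport G) (x₀ : X) :
    ∃ x : ℝ → X, x 0 = x₀ ∧ IsIntegralCurveOn x (fun _ => G) (Ici 0) := by
  obtain ⟨L₀, hL₀⟩ := hsupp.exists_bound_of_continuous hG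
  have hL₀' : 0 ≤ L₀ := (norm_nonneg _).trans (hL₀ 0)
  -- The extra `1` absorbs the error of the smooth approximations and keeps `L` positive for the
  -- later division.
  set L : NNReal := ⟨L₀ + 1, by positivity⟩ with hL
  have approx : ∀ n : ℕ, ∃ g : X → X, (∃ κ, LipschitzWith κ g) ∧
      (∀ y, ‖g y - G y‖ < 1 / (n + 1)) ∧ ∀ y, ‖g y‖ ≤ L := by
    intro n
    obtain ⟨g, hg, hd, hs⟩ := hG.exists_contDiff_approx 1
      (ε := fun _ => (1 : ℝ) / (n + 1)) continuous_const (fun _ => by positivity)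
    refine ⟨g, hg.lipschitzWith_of_hasCompactSupport (𝕂 := ℝ) (hsupp.mono hs) one_ne_zero,
      fun y => by simpa [dist_eq_norm] using hd y, fun y => ?_⟩
    have h1 : ‖g y - G y‖ < 1 / (n + 1) := by simpa [dist_eq_norm] using hd y
    have h2 : (1 : ℝ) / (n + 1) ≤ 1 := by
      rw [div_le_one (by positivity)]; linarith [Nat.cast_nonneg (α := ℝ) n]
    have h3 := norm_add_le (g y - G y) (G y)
    rw [sub_add_cancel] at h3
    have h4 := hL₀ y
    change ‖g y‖ ≤ L₀ + 1
    linarith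
  choose g hglip hgG hgL using approx
  choose κ hκ using hglip
  have sol : ∀ n : ℕ, ∃ x : ℝ → X, x 0 = x₀ ∧
      ∀ t ∈ Icc (0 : ℝ) n, HasDerivWithinAt x (g n (x t)) (Icc 0 n) t := by
    intro n
    have hn : (0 : ℝ) ≤ n := Nat.cast_nonneg n
    -- At speed at most `L`, the ball of radius `L * n` cannot be left before time `n`, so
    -- Picard-Lindelöf covers all of `[0, n]`.
    have hpl : IsPicardLindelof (fun _ => g n) (tmin := 0) (tmax := n) ⟨0, le_rfl, hn⟩ x₀
        (L * n) 0 L (κ n) :=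
      IsPicardLindelof.of_time_independent (fun y _ => hgL n y) ((hκ n).lipschitzOnWith) (by
        simp)
    exact hpl.exists_eq_forall_mem_Icc_hasDerivWithinAt₀
  choose x hx0 hx using sol
  have lip : ∀ n : ℕ, ∀ t ∈ Icc (0 : ℝ) n, ∀ s ∈ Icc (0 : ℝ) n, ‖x n s - x n t‖ ≤ L * |s - t| := by
    intro n t ht s hs
    simpa using (convex_Icc (0 : ℝ) n).norm_image_sub_le_of_norm_hasDerivWithin_le
      (hx n) (fun r _ => hgL n _) ht hs
  -- Limits along a free ultrafilter replace the Arzelà-Ascoli subsequence: pointwise limits exist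
  -- by boundedness and suffice below.
  set 𝒰 : Ultrafilter ℕ := hyperfilter ℕ with h𝒰
  have hU : (𝒰 : Filter ℕ) ≤ atTop := Nat.hyperfilter_le_atTop
  have mem : ∀ t : ℝ, 0 ≤ t → ∀ᶠ n : ℕ in (𝒰 : Filter ℕ), t ∈ Icc (0 : ℝ) n := fun t ht =>
    hU ((tendsto_natCast_atTop_atTop.eventually_ge_atTop t).mono fun n hn => ⟨ht, hn⟩)
  have lim : ∀ t : ℝ, ∃ y, 0 ≤ t → Tendsto (fun n => x n t) 𝒰 (𝓝 y) := by
    intro t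
    by_cases ht : 0 ≤ t
    · have hb : ∀ᶠ n in (𝒰 : Filter ℕ), x n t ∈ Metric.closedBall x₀ (L * t) := by
        filter_upwards [mem t ht, mem 0 le_rfl] with n h1 h2
        have := lip n 0 h2 t h1
        rw [hx0, sub_zero, abs_of_nonneg ht] at this
        simpa [dist_eq_norm] using this
      obtain ⟨y, -, hy⟩ := (isCompact_closedBall x₀ (L * t)).ultrafilter_le_nhds
        (𝒰.map fun n => x n t) (le_principal_iff.2 hb)
      exact ⟨y, fun _ => hy⟩
    · exact ⟨0, fun h => absurd h ht⟩
  choose y hy using lim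
  refine ⟨y, tendsto_nhds_unique (hy 0 le_rfl) (by simp [hx0]), fun t ht => ?_⟩
  rw [hasDerivWithinAt_iff_isLittleO, Asymptotics.isLittleO_iff]
  intro ε hε
  obtain ⟨δ, hδ, hGδ⟩ := Metric.uniformContinuous_iff.1
    (hsupp.uniformContinuous_of_continuous hG) (ε / 2) (half_pos hε)
  have hLpos : (0 : ℝ) < L := by change 0 < L₀ + 1; positivity
  have hnear : ∀ᶠ s in 𝓝[Ici 0] t, |s - t| < δ / L := by
    have : ∀ᶠ s in 𝓝 t, |s - t| < δ / L :=
      Metric.eventually_nhds_iff.2 ⟨δ / L, by positivity, fun s hs => by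
        simpa [Real.dist_eq] using hs⟩
    exact this.filter_mono nhdsWithin_le_nhds
  filter_upwards [hnear, self_mem_nhdsWithin] with s hst hs
  have hs : 0 ≤ s := hs
  have ht : 0 ≤ t := ht
  have htend : Tendsto (fun n => ‖x n s - x n t - (s - t) • G (x n t)‖) 𝒰
      (𝓝 ‖y s - y t - (s - t) • G (y t)‖) :=
    (((hy s hs).sub (hy t ht)).sub (((hG.tendsto _).comp (hy t ht)).const_smul _)).norm
  refine le_of_tendsto htend ?_
  -- Error budget: `ε/2` from uniform continuity of `G` and three approximation errors of `ε/8`,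
  -- together below `ε`.
  have hsmall : ∀ᶠ n : ℕ in (𝒰 : Filter ℕ), (1 : ℝ) / (n + 1) < ε / 8 :=
    hU (tendsto_one_div_add_atTop_nhds_zero_nat.eventually_lt_const (by positivity))
  filter_upwards [mem s hs, mem t ht, hsmall] with n hsn htn hn
  have h1 : ‖x n s - x n t - (s - t) • g n (x n t)‖ ≤ (ε / 2 + ε / 4) * |s - t| := by
    refine norm_sub_sub_smul_le_of_norm_deriv_sub_le (convex_Icc (0 : ℝ) n) (hx n) htn hsn
      fun r hr => ?_
    have hrn : r ∈ Icc (0 : ℝ) n := by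
      have : uIcc t s ⊆ Icc (0 : ℝ) n := by
        rw [← segment_eq_uIcc]; exact (convex_Icc (0 : ℝ) n).segment_subset htn hsn
      exact this hr
    have hd : dist (x n r) (x n t) < δ := by
      rw [dist_eq_norm]
      calc _ ≤ L * |r - t| := lip n t htn r hrn
        _ ≤ L * |s - t| := mul_le_mul_of_nonneg_left (abs_sub_left_of_mem_uIcc hr) L.2
        _ < L * (δ / L) := by gcongr
        _ = δ := by field_simp
    have h2 := hGδ hd
    rw [dist_eq_norm] at h2
    have h3 := hgG n (x n r)
    have h4 := hgG n (x n t)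
    rw [norm_sub_rev] at h4
    calc ‖g n (x n r) - g n (x n t)‖
        = ‖(g n (x n r) - G (x n r)) + (G (x n r) - G (x n t)) + (G (x n t) - g n (x n t))‖ := by
          congr 1; abel
      _ ≤ _ := norm_add₃_le
      _ ≤ _ := by linarith
  calc ‖x n s - x n t - (s - t) • G (x n t)‖
      = ‖(x n s - x n t - (s - t) • g n (x n t)) + (s - t) • (g n (x n t) - G (x n t))‖ := by
        congr 1; module
    _ ≤ (ε / 2 + ε / 4) * |s - t| + |s - t| * (ε / 8) := by
        refine (norm_add_le _ _).trans (add_le_add h1 ?_)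
        rw [norm_smul, Real.norm_eq_abs]
        gcongr
        exact (hgG n _).le.trans hn.le
    _ ≤ ε * ‖s - t‖ := by
        rw [Real.norm_eq_abs]; nlinarith [abs_nonneg (s - t)]

end ODE

/-! ### Forward invariance, continuation and convergence of integral curves. -/

section ODE

variable {X : Type*} [NormedAddCommGroup X] [NormedSpace ℝ X]

/-- Integral curves of `F` that are in `K` at some time remain in `K` for a short time. -/
def LocallyForwardInvariant (F : X → X) (K : Set X) : Prop :=
  ∀ (x : ℝ → X) (a b : ℝ), a < b → IsIntegralCurveOn x (fun _ => F) (Ico a b) → x a ∈ K →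
    ∀ᶠ t in 𝓝[>] a, x t ∈ K

/-- Continuous induction: the set of times spent in `K` is closed and can always be continued to the
right. -/
theorem LocallyForwardInvariant.mem {F : X → X} {K : Set X} (hinv : LocallyForwardInvariant F K)
    (hK : IsClosed K) {x : ℝ → X} {a b : ℝ} (hx : IsIntegralCurveOn x (fun _ => F) (Ico a b))
    (ha : x a ∈ K) {t : ℝ} (ht : t ∈ Ico a b) : x t ∈ K := by
  have hsub : Icc a t ⊆ Ico a b := Icc_subset_Ico_right ht.2
  have hcl : IsClosed (x ⁻¹' K ∩ Icc a t) := by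
    rw [inter_comm]
    exact (hx.continuousOn.mono hsub).preimage_isClosed_of_isClosed isClosed_Icc hK
  refine hcl.Icc_subset_of_forall_mem_nhdsWithin ha (fun s hs => ?_) (right_mem_Icc.2 ht.1)
  have hsb : s < b := hs.2.2.trans ht.2
  exact hinv x s b hsb (hx.mono (Ico_subset_Ico_left hs.2.1)) hs.1

theorem LocallyForwardInvariant.mem_of_Ici {F : X → X} {K : Set X}
    (hinv : LocallyForwardInvariant F K) (hK : IsClosed K) {x : ℝ → X}
    (hx : IsIntegralCurveOn x (fun _ => F) (Ici 0)) (h0 : x 0 ∈ K) {t : ℝ} (ht : 0 ≤ t) :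
    x t ∈ K :=
  hinv.mem hK (hx.mono Ico_subset_Ici_self) h0 ⟨ht, lt_add_one t⟩

/-- A continuous vector field has a global forward solution from every point of a compact
locally forward invariant set. -/
theorem LocallyForwardInvariant.exists_isIntegralCurveOn_Ici [FiniteDimensional ℝ X] {F : X → X}
    {K U : Set X} (hinv : LocallyForwardInvariant F K) (hK : IsCompact K) (hU : IsOpen U)
    (hKU : K ⊆ U) (hF : ContinuousOn F U) {x₀ : X} (hx₀ : x₀ ∈ K) :
    ∃ x : ℝ → X, x 0 = x₀ ∧ IsIntegralCurveOn x (fun _ => F) (Ici 0) := by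
  obtain ⟨K', hK', hKK', hK'U⟩ := exists_compact_between hK hU hKU
  obtain ⟨χ, hχ1, hχc, hχU, -⟩ := exists_continuousMap_one_of_isCompact_subset_isOpen hK' hU hK'U
  set G : X → X := fun y => χ y • F y with hG
  have hsub : tsupport G ⊆ tsupport χ := closure_mono (Function.support_smul_subset_left _ _)
  have hGc : Continuous G := by
    refine ContinuousOn.continuous_of_tsupport_subset
      (χ.continuous.continuousOn.smul hF) hU (hsub.trans hχU)
  have hGs : HasCompactSupport G := hχc.of_isClosed_subset (isClosed_tsupport _) hsub
  have hGF : ∀ y ∈ K', G y = F y := fun y hy => by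
    simp only [hG]; rw [hχ1 hy]; simp
  obtain ⟨x, h0, hx⟩ := exists_isIntegralCurveOn_Ici_of_hasCompactSupport hGc hGs x₀
  -- The cutoff equals `1` on a neighbourhood `K'` of `K`, and a curve of `G` starting in `K` is for
  -- a short time a curve of `F`.
  have hinvG : LocallyForwardInvariant G K := by
    intro y a b hab hy ha
    have hcont : ContinuousWithinAt y (Ico a b) a := hy.continuousOn a ⟨le_rfl, hab⟩
    have h1 : ∀ᶠ t in 𝓝[Ico a b] a, y t ∈ K' :=
      (hcont.eventually_mem (mem_interior_iff_mem_nhds.1 (hKK' ha)))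
    rw [nhdsWithin_Ico_eq_nhdsGE hab] at h1
    obtain ⟨c, hac, hc⟩ := mem_nhdsGE_iff_exists_Ico_subset.1 h1
    have hac : a < c := hac
    refine hinv y a (min b c) (lt_min hab hac) (fun t ht => ?_) ha
    have := hy t ⟨ht.1, ht.2.trans_le (min_le_left _ _)⟩
    have h2 : G (y t) = F (y t) := hGF _ (hc ⟨ht.1, ht.2.trans_le (min_le_right _ _)⟩)
    simp only at this
    rw [h2] at this
    exact this.mono (Ico_subset_Ico_right (min_le_left _ _))
  refine ⟨x, h0, fun t ht => ?_⟩
  have hm : x t ∈ K := hinvG.mem_of_Ici hK.isClosed hx (h0 ▸ hx₀) ht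
  have := hx t ht
  simp only at this
  rwa [hGF _ (interior_subset (hKK' hm))] at this

theorem lipschitzOnWith_of_isIntegralCurveOn {F : X → X} {K : Set X} {x : ℝ → X} {I : Set ℝ}
    (hI : Convex ℝ I) (hx : IsIntegralCurveOn x (fun _ => F) I) (hxK : ∀ t ∈ I, x t ∈ K)
    {B : NNReal} (hB : ∀ y ∈ K, ‖F y‖ ≤ B) : LipschitzOnWith B x I :=
  hI.lipschitzOnWith_of_nnnorm_hasDerivWithin_le hx fun t ht => hB _ (hxK t ht)

theorem IsCompact.exists_nnreal_bound_of_continuousOn {E Y : Type*} [TopologicalSpace E]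
    [NormedAddCommGroup Y] {F : E → Y} {K : Set E} (hK : IsCompact K)
    (hF : ContinuousOn F K) : ∃ B : NNReal, ∀ y ∈ K, ‖F y‖ ≤ B := by
  obtain ⟨B, hB⟩ := hK.exists_bound_of_continuousOn hF
  exact ⟨B.toNNReal, fun y hy => (hB y hy).trans (Real.le_coe_toNNReal B)⟩

/-- Only the junction needs an argument: the left derivative at `T` exists because `F ∘ x`, the
derivative before `T`, converges there to the velocity of `y`. -/
theorem IsIntegralCurveOn.glue_Ici {F : X → X} {x y : ℝ → X} {T : ℝ} (hT : 0 < T)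
    (hx : IsIntegralCurveOn x (fun _ => F) (Ico 0 T))
    (hy : IsIntegralCurveOn y (fun _ => F) (Ici 0))
    (hlim : Tendsto x (𝓝[<] T) (𝓝 (y 0))) (hF : Tendsto (F ∘ x) (𝓝[<] T) (𝓝 (F (y 0)))) :
    ∃ w : ℝ → X, IsIntegralCurveOn w (fun _ => F) (Ici 0) ∧ EqOn x w (Ico 0 T) := by
  set w : ℝ → X := fun t => if t < T then x t else y (t - T) with hw
  have hwx : ∀ t, t < T → w t = x t := fun t ht => if_pos ht
  have hwy : ∀ t, T ≤ t → w t = y (t - T) := fun t ht => if_neg ht.not_gt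
  have hwT : w T = y 0 := by rw [hwy T le_rfl, sub_self]
  refine ⟨w, fun t ht => ?_, fun t ht => (hwx t ht.2).symm⟩
  have ht : (0 : ℝ) ≤ t := ht
  have hright : ∀ t, T ≤ t → HasDerivWithinAt w (F (w t)) (Ici T) t := by
    intro t ht
    have h1 := hy (t - T) (sub_nonneg.2 ht)
    have h2 : HasDerivWithinAt (fun s => y (s - T)) (F (y (t - T))) (Ici T) t := by
      have := h1.scomp t ((hasDerivWithinAt_id t (Ici T)).sub_const T)
        (fun s hs => sub_nonneg.2 hs)
      simpa [Function.comp_def] using this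
    rw [hwy t ht]
    exact h2.congr (fun s hs => hwy s hs) (hwy t ht)
  rcases lt_trichotomy t T with h | h | h
  · have h1 := hx t ⟨ht, h⟩
    rw [hwx t h]
    have h2 : HasDerivWithinAt w (F (x t)) (Ico 0 T) t :=
      h1.congr (fun s hs => hwx s hs.2) (hwx t h)
    exact h2.mono_of_mem_nhdsWithin
      (mem_nhdsWithin.2 ⟨Iio T, isOpen_Iio, h, fun s hs => ⟨hs.2, hs.1⟩⟩)
  · subst h
    have hd : ∀ s ∈ Ioo 0 t, HasDerivAt w (F (x s)) s := fun s hs => by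
      have h1 : HasDerivAt x (F (x s)) s :=
        (hx s ⟨hs.1.le, hs.2⟩).hasDerivAt (Ico_mem_nhds hs.1 hs.2)
      exact h1.congr_of_eventuallyEq
        ((eventually_lt_nhds hs.2).mono fun r hr => hwx r hr)
    have hIoo : Ioo 0 t ∈ 𝓝[<] t := Ioo_mem_nhdsLT hT
    have hleft : HasDerivWithinAt w (F (w t)) (Iic t) t := by
      refine hasDerivWithinAt_Iic_of_tendsto_deriv (s := Ioo 0 t)
        (fun s hs => (hd s hs).differentiableAt.differentiableWithinAt) ?_ hIoo ?_
      · rw [ContinuousWithinAt, hwT]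
        have h3 : Tendsto x (𝓝[Ioo 0 t] t) (𝓝 (y 0)) :=
          hlim.mono_left (nhdsWithin_mono _ fun s hs => hs.2)
        exact h3.congr' (eventually_nhdsWithin_of_forall fun s hs => (hwx s hs.2).symm)
      · rw [hwT]
        exact hF.congr' (by filter_upwards [hIoo] with s hs using (hd s hs).deriv.symm)
    have := hleft.union (hright t le_rfl)
    rw [Iic_union_Ici] at this
    exact this.mono (subset_univ _)
  · exact (hright t h.le).mono_of_mem_nhdsWithin
      (mem_nhdsWithin_of_mem_nhds (Ici_mem_nhds h))

/-- A forward solution that lives in a compact locally forward invariant set can be continued to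
all positive times. -/
theorem LocallyForwardInvariant.exists_extension [FiniteDimensional ℝ X] {F : X → X}
    {K U : Set X} (hinv : LocallyForwardInvariant F K) (hK : IsCompact K) (hU : IsOpen U)
    (hKU : K ⊆ U) (hF : ContinuousOn F U) {x : ℝ → X} {T : ℝ} (hT : 0 < T)
    (hx : IsIntegralCurveOn x (fun _ => F) (Ico 0 T)) (h0 : x 0 ∈ K) :
    ∃ y : ℝ → X, IsIntegralCurveOn y (fun _ => F) (Ici 0) ∧ EqOn x y (Ico 0 T) := by
  have hxK : ∀ t ∈ Ico 0 T, x t ∈ K := fun t ht => hinv.mem hK.isClosed hx h0 ht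
  obtain ⟨B, hB⟩ := hK.exists_nnreal_bound_of_continuousOn (hF.mono hKU)
  have hlip := lipschitzOnWith_of_isIntegralCurveOn (convex_Ico 0 T) hx hxK hB
  obtain ⟨x', hx', heq⟩ := hlip.extend_finite_dimension
  have hlim : Tendsto x (𝓝[<] T) (𝓝 (x' T)) := by
    have h1 : Tendsto x' (𝓝[<] T) (𝓝 (x' T)) := hx'.continuous.continuousAt.mono_left
      nhdsWithin_le_nhds
    refine h1.congr' ?_
    filter_upwards [Ico_mem_nhdsLT hT] with t ht using (heq ht).symm
  have hmem : x' T ∈ K := hK.isClosed.mem_of_tendsto hlim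
    (by filter_upwards [Ico_mem_nhdsLT hT] with t ht using hxK t ht)
  obtain ⟨y, hy0, hy⟩ := hinv.exists_isIntegralCurveOn_Ici hK hU hKU hF hmem
  rw [← hy0] at hlim hmem
  have hFc : ContinuousAt F (y 0) := hF.continuousAt (hU.mem_nhds (hKU hmem))
  obtain ⟨w, hw, hxw⟩ := hx.glue_Ici hT hy hlim (hFc.tendsto.comp hlim)
  exact ⟨w, hw, hxw⟩

/-- If `f` converges and has a uniformly continuous derivative, then the derivative tends to
zero (Barbalat). -/
theorem tendsto_zero_of_uniformContinuousOn_deriv {f f' : ℝ → X} {l : X}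
    (hf : ∀ t ∈ Ici (0 : ℝ), HasDerivWithinAt f (f' t) (Ici 0) t)
    (hu : UniformContinuousOn f' (Ici 0)) (hl : Tendsto f atTop (𝓝 l)) :
    Tendsto f' atTop (𝓝 0) := by
  rw [Metric.tendsto_nhds]
  intro ε hε
  obtain ⟨δ, hδ, hδ'⟩ := Metric.uniformContinuousOn_iff.1 hu (ε / 2) (half_pos hε)
  set d := δ / 2 with hd
  have hdpos : 0 < d := half_pos hδ
  have h1 : Tendsto (fun t => f (t + d) - f t) atTop (𝓝 0) := by
    simpa using (hl.comp (tendsto_atTop_add_const_right atTop d tendsto_id)).sub hl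
  have h2 := Metric.tendsto_nhds.1 h1 (ε / 2 * d) (by positivity)
  filter_upwards [h2, eventually_ge_atTop 0] with t ht ht0
  rw [dist_zero_right] at ht ⊢
  have h3 := norm_sub_sub_smul_le_of_norm_deriv_sub_le (convex_Ici (0 : ℝ)) hf (t := t)
    (s := t + d) (C := ε / 2) ht0 (add_nonneg ht0 hdpos.le) (fun r hr => by
      rw [uIcc_of_le (by linarith)] at hr
      rw [← dist_eq_norm]
      refine (hδ' r (ht0.trans hr.1) t ht0 ?_).le
      rw [Real.dist_eq, abs_of_nonneg (by linarith [hr.1])]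
      linarith [hr.2])
  rw [add_sub_cancel_left, abs_of_pos hdpos] at h3
  have h4 : ‖d • f' t‖ < ε * d := by
    calc ‖d • f' t‖ = ‖(f (t + d) - f t) - (f (t + d) - f t - d • f' t)‖ := by congr 1; abel
      _ ≤ ‖f (t + d) - f t‖ + ‖f (t + d) - f t - d • f' t‖ := norm_sub_le _ _
      _ < ε * d := by linarith
  rw [norm_smul, Real.norm_eq_abs, abs_of_pos hdpos, mul_comm] at h4
  exact lt_of_mul_lt_mul_right h4 hdpos.le

/-- On a compact set, a curve tends to zero if a continuous function with no other zero does so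
along it. -/
theorem IsCompact.tendsto_of_tendsto_comp {E Y ι : Type*} [PseudoMetricSpace E]
    [NormedAddCommGroup Y] {G : E → Y} {K : Set E} (hK : IsCompact K) (hG : ContinuousOn G K) {p : E}
    (hzero : ∀ y ∈ K, G y = 0 → y = p) {l : Filter ι} {x : ι → E} (hx : ∀ᶠ t in l, x t ∈ K)
    (hGx : Tendsto (fun t => G (x t)) l (𝓝 0)) : Tendsto x l (𝓝 p) := by
  rw [Metric.tendsto_nhds]
  intro ε hε
  set K' := K ∩ (Metric.ball p ε)ᶜ with hK'
  have hK'c : IsCompact K' := hK.inter_right Metric.isOpen_ball.isClosed_compl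
  rcases K'.eq_empty_or_nonempty with he | hne
  · filter_upwards [hx] with t ht
    by_contra h
    exact (he ▸ (show x t ∈ K' from ⟨ht, h⟩) : x t ∈ (∅ : Set E))
  · obtain ⟨m, hm, hmin⟩ := hK'c.exists_isMinOn hne ((hG.mono inter_subset_left).norm)
    have hpos : 0 < ‖G m‖ := norm_pos_iff.2 fun h0 => hm.2 (by
      rw [hzero m hm.1 h0]; exact Metric.mem_ball_self hε)
    have h1 := Metric.tendsto_nhds.1 hGx _ hpos
    filter_upwards [hx, h1] with t ht ht1
    by_contra h
    rw [dist_zero_right] at ht1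
    exact absurd (hmin (show x t ∈ K' from ⟨ht, h⟩)) (not_le.2 ht1)

end ODE

/-! ### Positive-definite matrices. -/

section PosDef

variable {n : ℕ} {A : Mat n}

theorem SymPosDef.inner_nonneg (hA : SymPosDef A) (v : Vec n) : 0 ≤ inner ℝ v (A v) := by
  rcases eq_or_ne v 0 with rfl | h
  · simp
  · exact (hA.pos v h).le

theorem SymPosDef.eq_zero_of_inner_nonpos (hA : SymPosDef A) {v : Vec n}
    (h : inner ℝ v (A v) ≤ 0) : v = 0 := by
  by_contra hv
  exact absurd (hA.pos v hv) (not_lt.2 h)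

theorem SymPosDef.isInvertible (hA : SymPosDef A) : A.IsInvertible := by
  have hinj : Function.Injective (A : Vec n →ₗ[ℝ] Vec n) := by
    rw [← LinearMap.ker_eq_bot, LinearMap.ker_eq_bot']
    intro v hv
    have hv : A v = 0 := hv
    exact hA.eq_zero_of_inner_nonpos (by rw [hv, inner_zero_right])
  exact ⟨(LinearEquiv.ofInjectiveEndo _ hinj).toContinuousLinearEquiv, by ext v; rfl⟩

theorem SymPosDef.inner_inverse_pos (hA : SymPosDef A) {w : Vec n} (hw : w ≠ 0) :
    0 < inner ℝ w (A.inverse w) := by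
  have h := hA.isInvertible.self_apply_inverse w
  have h0 : A.inverse w ≠ 0 := fun h0 => hw (by rw [← h, h0, map_zero])
  have := hA.pos _ h0
  rwa [h, real_inner_comm] at this

end PosDef

/-! ### Derivatives and continuity of the barrier and energy functions. -/

namespace MechanicalSystem

variable {n : ℕ} (S : MechanicalSystem n) {q : Vec n}

theorem isOpen_stateSpace : IsOpen S.stateSpace := S.isOpen_Q₀.prod isOpen_univ

theorem mem_stateSpace {x : Vec n × Vec n} : x ∈ S.stateSpace ↔ x.1 ∈ S.Q₀ := by
  simp [stateSpace]

theorem mapsTo_fst : MapsTo Prod.fst S.stateSpace S.Q₀ := fun _ hx => S.mem_stateSpace.1 hx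

theorem M_Minv (hq : q ∈ S.Q₀) (w : Vec n) : S.M q (S.Minv q w) = w :=
  (S.M_posDef q hq).isInvertible.self_apply_inverse w

theorem Minv_pos (hq : q ∈ S.Q₀) {w : Vec n} (hw : w ≠ 0) : 0 < inner ℝ w (S.Minv q w) :=
  (S.M_posDef q hq).inner_inverse_pos hw

theorem Minv_eq_zero (hq : q ∈ S.Q₀) {w : Vec n} (hw : S.Minv q w = 0) : w = 0 := by
  rw [← S.M_Minv hq w, hw, map_zero]

theorem continuousOn_Minv : ContinuousOn S.Minv S.Q₀ := fun q hq =>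
  ((S.M_posDef q hq).isInvertible.contDiffAt_map_inverse (𝕜 := ℝ) (n := 0)).continuousAt
    |>.comp_continuousWithinAt (S.M_contDiffOn.continuousOn q hq)

theorem continuousOn_C : ContinuousOn (fun x : Vec n × Vec n => S.C x.1 x.2) S.stateSpace :=
  S.C_lipschitz.continuousOn

theorem continuousOn_τg : ContinuousOn S.τg S.Q₀ := S.τg_lipschitz.continuousOn

theorem differentiableAt_M (hq : q ∈ S.Q₀) : DifferentiableAt ℝ S.M q :=
  (S.M_contDiffOn.differentiableOn one_ne_zero).differentiableAt (S.isOpen_Q₀.mem_nhds hq)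

theorem drift_add_inputMap (x : Vec n × Vec n) (u : Vec n) :
    S.drift x + S.inputMap x u = (x.2, S.Minv x.1 (-(S.C x.1 x.2 x.2) - S.τg x.1 + u)) := by
  ext1 <;> simp [drift, inputMap]

end MechanicalSystem

namespace SafetyDesign

variable {n : ℕ} {S : MechanicalSystem n} (K : SafetyDesign S) {q : Vec n} {x : Vec n × Vec n}

theorem differentiableAt_c (hq : q ∈ S.Q₀) : DifferentiableAt ℝ K.c q :=
  (K.c_contDiffOn.differentiableOn two_ne_zero).differentiableAt (S.isOpen_Q₀.mem_nhds hq)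

theorem contDiffOn_fderiv_c : ContDiffOn ℝ 1 (fderiv ℝ K.c) S.Q₀ :=
  K.c_contDiffOn.fderiv_of_isOpen S.isOpen_Q₀ (by norm_num)

theorem differentiableAt_fderiv_c (hq : q ∈ S.Q₀) : DifferentiableAt ℝ (fderiv ℝ K.c) q :=
  (K.contDiffOn_fderiv_c.differentiableOn one_ne_zero).differentiableAt (S.isOpen_Q₀.mem_nhds hq)

theorem continuousOn_c : ContinuousOn K.c S.Q₀ := K.c_contDiffOn.continuousOn

theorem continuousOn_gradient : ContinuousOn (gradient K.c) S.Q₀ :=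
  (InnerProductSpace.toDual ℝ (Vec n)).symm.continuous.comp_continuousOn
    K.contDiffOn_fderiv_c.continuousOn

theorem continuousOn_hessian : ContinuousOn (fderiv ℝ (fderiv ℝ K.c)) S.Q₀ :=
  K.contDiffOn_fderiv_c.continuousOn_fderiv_of_isOpen S.isOpen_Q₀ le_rfl

theorem cdot_eq (x : Vec n × Vec n) : K.cdot x = fderiv ℝ K.c x.1 x.2 := inner_gradient_left

theorem hasFDerivAt_h (hx : x ∈ S.stateSpace) :
    HasFDerivAt K.h
      ((((fderiv ℝ K.c x.1).comp (ContinuousLinearMap.snd ℝ (Vec n) (Vec n))) +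
        ((fderiv ℝ (fderiv ℝ K.c) x.1).comp
          (ContinuousLinearMap.fst ℝ (Vec n) (Vec n))).flip x.2) +
        deriv K.φ (K.c x.1) • (fderiv ℝ K.c x.1).comp
          (ContinuousLinearMap.fst ℝ (Vec n) (Vec n))) x := by
  have hq := S.mapsTo_fst hx
  have h1 : HasFDerivAt (fun y : Vec n × Vec n => fderiv ℝ K.c y.1) _ x :=
    (K.differentiableAt_fderiv_c hq).hasFDerivAt.comp x hasFDerivAt_fst
  have h2 := h1.clm_apply (hasFDerivAt_snd (𝕜 := ℝ) (p := x))
  have h3 : HasFDerivAt (fun y : Vec n × Vec n => K.c y.1) _ x :=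
    (K.differentiableAt_c hq).hasFDerivAt.comp x hasFDerivAt_fst
  have h4 := ((K.φ_contDiff.differentiable one_ne_zero) (K.c x.1)).hasDerivAt.comp_hasFDerivAt x h3
  refine (h2.add h4).congr_of_eventuallyEq (Eventually.of_forall fun y => ?_)
  simp [h, cdot_eq]

theorem fderiv_h_apply (hx : x ∈ S.stateSpace) (a b : Vec n) :
    fderiv ℝ K.h x (a, b) = fderiv ℝ K.c x.1 b + fderiv ℝ (fderiv ℝ K.c) x.1 a x.2
      + deriv K.φ (K.c x.1) * fderiv ℝ K.c x.1 a := by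
  rw [(K.hasFDerivAt_h hx).fderiv]; simp

/-- Measuring `u` from the nominal control makes `z - α(h)` the nominal rate of `h`, so only the
correction has to be examined afterwards. -/
theorem fderiv_h_drift_add_inputMap (hx : x ∈ S.stateSpace) (u : Vec n) :
    fderiv ℝ K.h x (S.drift x + S.inputMap x u)
      = K.z x - K.α (K.h x) + inner ℝ (gradient K.c x.1) (S.Minv x.1 (u - K.nominal x)) := by
  have h1 : S.inputMap x u = S.inputMap x (K.nominal x) + S.inputMap x (u - K.nominal x) := by
    rw [← map_add]; congr 1; abel
  have h2 : fderiv ℝ K.h x (S.inputMap x (u - K.nominal x))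
      = inner ℝ (gradient K.c x.1) (S.Minv x.1 (u - K.nominal x)) := by
    have : S.inputMap x (u - K.nominal x) = (0, S.Minv x.1 (u - K.nominal x)) := rfl
    rw [this, K.fderiv_h_apply hx, inner_gradient_left]
    simp
  rw [h1, map_add, map_add, h2, z, MechanicalSystem.lieDrift, MechanicalSystem.lieInput,
    ContinuousLinearMap.comp_apply]
  ring

/-- Gravity compensation cancels `τg`. The explicit form yields both the continuity of `z` and its
lower bound in powers of `‖v‖`. -/
theorem z_eq (hx : x ∈ S.stateSpace) :
    K.z x = fderiv ℝ (fderiv ℝ K.c) x.1 x.2 x.2 + deriv K.φ (K.c x.1) * K.cdot x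
      - inner ℝ (gradient K.c x.1) (S.Minv x.1 (S.C x.1 x.2 x.2))
      - inner ℝ (gradient K.c x.1) (S.Minv x.1 (K.Kp x.1))
      - inner ℝ (gradient K.c x.1) (S.Minv x.1 (K.Kd x.2)) + K.α (K.h x) := by
  have h1 := K.fderiv_h_drift_add_inputMap hx (K.nominal x)
  rw [S.drift_add_inputMap, K.fderiv_h_apply hx, sub_self, map_zero, inner_zero_right, add_zero,
    ← inner_gradient_left, ← K.cdot_eq] at h1
  have h2 : -(S.C x.1 x.2 x.2) - S.τg x.1 + K.nominal x
      = -(S.C x.1 x.2 x.2) - K.Kp x.1 - K.Kd x.2 := by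
    rw [nominal]; abel
  rw [h2, map_sub, map_sub, map_neg, inner_sub_right, inner_sub_right, inner_neg_right] at h1
  linarith

theorem continuousOn_cdot : ContinuousOn K.cdot S.stateSpace :=
  (K.continuousOn_gradient.comp continuousOn_fst S.mapsTo_fst).inner continuousOn_snd

theorem continuousOn_h : ContinuousOn K.h S.stateSpace := fun _ hx =>
  (K.hasFDerivAt_h hx).continuousAt.continuousWithinAt

theorem continuousOn_gradNormSq : ContinuousOn K.gradNormSq S.Q₀ :=
  K.continuousOn_gradient.inner (S.continuousOn_Minv.clm_apply K.continuousOn_gradient)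

theorem continuousOn_nominal : ContinuousOn K.nominal S.stateSpace :=
  ((S.continuousOn_τg.comp continuousOn_fst S.mapsTo_fst).sub
    (K.Kp.continuous.comp_continuousOn continuousOn_fst)).sub
    (K.Kd.continuous.comp_continuousOn continuousOn_snd)

theorem continuousOn_z : ContinuousOn K.z S.stateSpace := by
  have hfst := continuousOn_fst (s := S.stateSpace)
  have hsnd := continuousOn_snd (s := S.stateSpace)
  have hgrad := K.continuousOn_gradient.comp hfst S.mapsTo_fst
  have hMinv := S.continuousOn_Minv.comp hfst S.mapsTo_fst
  have hess := K.continuousOn_hessian.comp hfst S.mapsTo_fst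
  have hφ := (K.φ_contDiff.continuous_deriv le_rfl).comp_continuousOn
    (K.continuousOn_c.comp hfst S.mapsTo_fst)
  have hα := K.α_classK.continuous.comp_continuousOn K.continuousOn_h
  refine ContinuousOn.congr ?_ fun x hx => K.z_eq hx
  exact (((((hess.clm_apply hsnd).clm_apply hsnd).add (hφ.mul K.continuousOn_cdot)).sub
    (hgrad.inner (hMinv.clm_apply (S.continuousOn_C.clm_apply hsnd)))).sub
    (hgrad.inner (hMinv.clm_apply (K.Kp.continuous.comp_continuousOn hfst)))).sub
    (hgrad.inner (hMinv.clm_apply (K.Kd.continuous.comp_continuousOn hsnd))) |>.add hα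

/-! ### Energy -/

theorem contDiffOn_energy : ContDiffOn ℝ 1 K.energy S.stateSpace := by
  have hM : ContDiffOn ℝ 1 (fun x : Vec n × Vec n => S.M x.1) S.stateSpace :=
    S.M_contDiffOn.comp contDiffOn_fst S.mapsTo_fst
  exact (contDiffOn_const.mul (contDiffOn_snd.inner ℝ (hM.clm_apply contDiffOn_snd))).add
    (contDiffOn_const.mul (contDiffOn_fst.inner ℝ (K.Kp.contDiff.comp_contDiffOn contDiffOn_fst)))

theorem differentiableAt_energy (hx : x ∈ S.stateSpace) : DifferentiableAt ℝ K.energy x :=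
  (K.contDiffOn_energy.differentiableOn one_ne_zero).differentiableAt
    (S.isOpen_stateSpace.mem_nhds hx)

theorem fderiv_energy_apply (hx : x ∈ S.stateSpace) (a b : Vec n) :
    fderiv ℝ K.energy x (a, b) = (1 / 2) * inner ℝ x.2 (fderiv ℝ S.M x.1 a x.2)
      + inner ℝ x.2 (S.M x.1 b) + inner ℝ a (K.Kp x.1) := by
  have hq := S.mapsTo_fst hx
  have h1 : HasFDerivAt (fun y : Vec n × Vec n => S.M y.1) _ x :=
    (S.differentiableAt_M hq).hasFDerivAt.comp x hasFDerivAt_fst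
  have h2 := (hasFDerivAt_snd (𝕜 := ℝ) (p := x)).inner ℝ
    (h1.clm_apply (hasFDerivAt_snd (𝕜 := ℝ) (p := x)))
  have h3 := (hasFDerivAt_fst (𝕜 := ℝ) (p := x)).inner ℝ
    (K.Kp.hasFDerivAt.comp x (hasFDerivAt_fst (𝕜 := ℝ) (p := x)))
  have h4 := (h2.const_mul (1 / 2)).add (h3.const_mul (1 / 2))
  have h5 : HasFDerivAt K.energy _ x := h4
  rw [h5.fderiv]
  have h6 := (S.M_posDef _ hq).symm x.2 b
  have h7 := K.Kp_posDef.symm x.1 a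
  simp [inner_add_right]
  rw [real_inner_comm (S.M x.1 x.2) b, h6, ← h7, real_inner_comm a (K.Kp x.1)]
  ring

/-- The Coriolis identity tested against `v` gives `vᵀCv = ½ vᵀṀv`, which cancels the derivative of
the inertia matrix. -/
theorem fderiv_energy_drift_add_inputMap (hx : x ∈ S.stateSpace) (u : Vec n) :
    fderiv ℝ K.energy x (S.drift x + S.inputMap x u)
      = inner ℝ x.2 (u - S.τg x.1 + K.Kp x.1) := by
  have hq := S.mapsTo_fst hx
  rw [S.drift_add_inputMap, K.fderiv_energy_apply hx, S.M_Minv hq]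
  have h1 := S.C_coriolis x.1 hq x.2 x.2
  rw [real_inner_comm x.2, real_inner_comm x.2 (fderiv ℝ S.M x.1 x.2 x.2)] at h1
  simp only [inner_add_right, inner_sub_right, inner_neg_right]
  linarith

end SafetyDesign

/-- Let `s` be the root, `ψ s² = a s + b`. If `ρ r < 1` then `s r < 1`, and multiplying `h` by `s²`
gives `ψ s² < a s (s r) + b (s r)² ≤ a s + b`, a contradiction. -/
theorem one_le_mul_of_positiveRoot_le {ψ a b ρ r : ℝ} (hψ : 0 < ψ) (ha : 0 ≤ a) (hb : 0 ≤ b)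
    (hr : 0 ≤ r) (hρ : (a + √(a ^ 2 + 4 * ψ * b)) / (2 * ψ) ≤ ρ)
    (h : ψ < a * r + b * r ^ 2) : 1 ≤ ρ * r := by
  set s := (a + √(a ^ 2 + 4 * ψ * b)) / (2 * ψ) with hs
  have hs0 : 0 ≤ s := by positivity
  have hroot : ψ * s ^ 2 = a * s + b := by
    have h1 : 2 * ψ * s - a = √(a ^ 2 + 4 * ψ * b) := by rw [hs]; field_simp; ring
    have h2 := Real.sq_sqrt (show 0 ≤ a ^ 2 + 4 * ψ * b by positivity)
    rw [← h1] at h2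
    have h3 : 4 * ψ * (ψ * s ^ 2) = 4 * ψ * (a * s + b) := by linarith
    exact mul_left_cancel₀ (by positivity) h3
  by_contra! hlt
  have hsr : s * r < 1 := (mul_le_mul_of_nonneg_right hρ hr).trans_lt hlt
  -- When `s = 0` the multiplication by `s²` is useless, but then `a = b = 0` and `h` reads `ψ < 0`.
  rcases hs0.eq_or_lt with h0 | hpos
  · have ha0 : a + √(a ^ 2 + 4 * ψ * b) = 0 := by
      rw [hs] at h0
      rcases div_eq_zero_iff.1 h0.symm with h | h
      · exact h
      · linarith
    have ha' : a = 0 := by linarith [Real.sqrt_nonneg (a ^ 2 + 4 * ψ * b)]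
    have hb' : b = 0 := by
      rw [← h0] at hroot
      linarith
    rw [ha', hb'] at h
    linarith
  · have h1 : ψ * s ^ 2 < (a * r + b * r ^ 2) * s ^ 2 := by gcongr
    have h2 : (a * r + b * r ^ 2) * s ^ 2 = a * s * (s * r) + b * (s * r) ^ 2 := by ring
    have h3 : a * s * (s * r) ≤ a * s * 1 := by gcongr
    have h4 : b * (s * r) ^ 2 ≤ b * 1 := by
      gcongr
      exact pow_le_one₀ (by positivity) hsr.le
    linarith

/-! ### The augmented control: continuity, barrier rate and energy rate. -/

namespace SafetyDesign

variable {n : ℕ} {S : MechanicalSystem n} (K : SafetyDesign S) {q : Vec n} {x : Vec n × Vec n}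

theorem gradNormSq_nonneg (hq : q ∈ S.Q₀) : 0 ≤ K.gradNormSq q := by
  rcases eq_or_ne (gradient K.c q) 0 with h | h
  · simp [gradNormSq, h]
  · exact (S.Minv_pos hq h).le

theorem gradient_eq_zero_of_gradNormSq (hq : q ∈ S.Q₀) (h : K.gradNormSq q = 0) :
    gradient K.c q = 0 := by
  by_contra h0
  exact (S.Minv_pos hq h0).ne' h

/-- The multiplier of `∇c` in the corrected control law. -/
noncomputable def multiplier (x : Vec n × Vec n) : ℝ := min (K.z x) 0 / K.gradNormSq x.1

/-- The switching surfaces disappear into `min z 0` and `max ċ 0`, so continuity can fail only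
through the division by `‖∇c‖²`. -/
theorem augControl_eq (ρ : ℝ) (x : Vec n × Vec n) :
    K.augControl ρ x = K.nominal x - K.multiplier x • gradient K.c x.1
      + (ρ ^ 2 * K.multiplier x * max (K.cdot x) 0) • x.2 := by
  rw [augControl, multiplier]
  split_ifs with h1 h2
  · simp [min_eq_right h1]
  · rw [min_eq_left (not_le.1 h1).le, max_eq_right h2, ubar]; simp
  · rw [min_eq_left (not_le.1 h1).le, max_eq_left (not_le.1 h2).le, ubar]
    congr 2; ring

theorem multiplier_nonpos (hx : x ∈ S.stateSpace) : K.multiplier x ≤ 0 :=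
  div_nonpos_of_nonpos_of_nonneg (min_le_right _ _) (K.gradNormSq_nonneg (S.mapsTo_fst hx))

theorem multiplier_eq_zero (hz : 0 ≤ K.z x) : K.multiplier x = 0 := by
  simp [multiplier, min_eq_right hz]

/-- States at which the control law is continuous. -/
def regularRegion : Set (Vec n × Vec n) :=
  {x | x ∈ S.stateSpace ∧ (0 < K.z x ∨ K.gradNormSq x.1 ≠ 0)}

theorem regularRegion_subset : K.regularRegion ⊆ S.stateSpace := fun _ hx => hx.1

theorem isOpen_regularRegion : IsOpen K.regularRegion := by
  have h1 := K.continuousOn_z.isOpen_inter_preimage S.isOpen_stateSpace isOpen_Ioi (t := Ioi 0)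
  have h2 := (K.continuousOn_gradNormSq.comp continuousOn_fst
    S.mapsTo_fst).isOpen_inter_preimage S.isOpen_stateSpace (isOpen_ne (x := (0 : ℝ)))
  convert h1.union h2 using 1
  rw [← inter_union_distrib_left]
  rfl

/-- Where the denominator vanishes, the region guarantees `z > 0`, so both sides are zero. -/
theorem multiplier_mul_gradNormSq (hx : x ∈ K.regularRegion) :
    K.multiplier x * K.gradNormSq x.1 = min (K.z x) 0 := by
  rcases hx.2 with h | h
  · rw [K.multiplier_eq_zero h.le, min_eq_right h.le, zero_mul]
  · rw [multiplier, div_mul_cancel₀ _ h]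

theorem continuousOn_multiplier : ContinuousOn K.multiplier K.regularRegion := by
  intro x hx
  have hz := K.continuousOn_z.continuousAt (S.isOpen_stateSpace.mem_nhds hx.1)
  have hg := (K.continuousOn_gradNormSq.comp continuousOn_fst
    S.mapsTo_fst).continuousAt (S.isOpen_stateSpace.mem_nhds hx.1)
  refine ContinuousAt.continuousWithinAt ?_
  rcases hx.2 with h | h
  · refine (continuousAt_const (y := (0 : ℝ))).congr ?_
    filter_upwards [hz.eventually_const_lt h] with y hy using (K.multiplier_eq_zero hy.le).symm
  · exact (hz.min continuousAt_const).div hg h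

theorem continuousOn_augControl (ρ : ℝ) : ContinuousOn (K.augControl ρ) K.regularRegion := by
  have hgrad := (K.continuousOn_gradient.comp continuousOn_fst S.mapsTo_fst).mono
    K.regularRegion_subset
  have hk := K.continuousOn_nominal.mono K.regularRegion_subset
  have hc := K.continuousOn_cdot.mono K.regularRegion_subset
  have ha := K.continuousOn_multiplier
  refine ContinuousOn.congr ?_ fun x _ => K.augControl_eq ρ x
  exact (hk.sub (ha.smul hgrad)).add
    (((continuousOn_const.mul ha).mul ((continuous_id.max continuous_const).comp_continuousOn hc)).smul continuousOn_snd)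

theorem closedLoop_eq (ρ : ℝ) (x : Vec n × Vec n) :
    K.closedLoop ρ x = (x.2, S.Minv x.1 (-(S.C x.1 x.2 x.2) - S.τg x.1 + K.augControl ρ x)) :=
  S.drift_add_inputMap x _

theorem continuousOn_closedLoop (ρ : ℝ) : ContinuousOn (K.closedLoop ρ) K.regularRegion := by
  have hMinv := (S.continuousOn_Minv.comp continuousOn_fst S.mapsTo_fst).mono
    K.regularRegion_subset
  have hτ := (S.continuousOn_τg.comp continuousOn_fst S.mapsTo_fst).mono
    K.regularRegion_subset
  have hC := S.continuousOn_C.mono K.regularRegion_subset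
  refine ContinuousOn.congr ?_ fun x _ => K.closedLoop_eq ρ x
  exact continuousOn_snd.prodMk (hMinv.clm_apply
    ((((hC.clm_apply continuousOn_snd).neg).sub hτ).add (K.continuousOn_augControl ρ)))

/-- The `∇c` correction turns `z` into `max z 0`. The `ρ` term has no definite sign, but its factor
`max ċ 0` is what makes it harmless for invariance. -/
theorem fderiv_h_closedLoop (ρ : ℝ) (hx : x ∈ K.regularRegion) :
    fderiv ℝ K.h x (K.closedLoop ρ x) = max (K.z x) 0 - K.α (K.h x)
      + ρ ^ 2 * K.multiplier x * inner ℝ (gradient K.c x.1) (S.Minv x.1 x.2)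
        * max (K.cdot x) 0 := by
  have h1 : K.augControl ρ x - K.nominal x = -(K.multiplier x • gradient K.c x.1)
      + (ρ ^ 2 * K.multiplier x * max (K.cdot x) 0) • x.2 := by
    rw [K.augControl_eq]; abel
  have h2 := K.multiplier_mul_gradNormSq hx
  have h3 := min_add_max (K.z x) 0
  rw [gradNormSq] at h2
  rw [closedLoop, K.fderiv_h_drift_add_inputMap hx.1, h1, map_add, map_neg, map_smul, map_smul,
    inner_add_right, inner_neg_right, real_inner_smul_right, real_inner_smul_right, h2]
  linarith

theorem inner_augControl_sub_nominal (ρ : ℝ) (x : Vec n × Vec n) :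
    inner ℝ x.2 (K.augControl ρ x - K.nominal x)
      = -(K.multiplier x) * (K.cdot x - ρ ^ 2 * ‖x.2‖ ^ 2 * max (K.cdot x) 0) := by
  have h1 : K.augControl ρ x - K.nominal x = -(K.multiplier x • gradient K.c x.1)
      + (ρ ^ 2 * K.multiplier x * max (K.cdot x) 0) • x.2 := by
    rw [K.augControl_eq]; abel
  rw [h1, inner_add_right, inner_neg_right, real_inner_smul_right, real_inner_smul_right,
    real_inner_self_eq_norm_sq, real_inner_comm, ← cdot]
  ring

theorem fderiv_energy_portedLoop (ρ : ℝ) (hx : x ∈ S.stateSpace) (μ : Vec n) :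
    fderiv ℝ K.energy x (K.portedLoop ρ x μ)
      = inner ℝ μ x.2 + inner ℝ x.2 (K.augControl ρ x - K.nominal x) := by
  rw [portedLoop, K.fderiv_energy_drift_add_inputMap hx, real_inner_comm _ μ, ← inner_add_right,
    nominal]
  congr 1; abel

theorem closedLoop_eq_portedLoop (ρ : ℝ) (x : Vec n × Vec n) :
    K.closedLoop ρ x = K.portedLoop ρ x (-K.Kd x.2) := by
  rw [closedLoop, portedLoop, add_neg_cancel_right]

theorem deriv_φ_nonneg (s : ℝ) : 0 ≤ deriv K.φ s := K.φ_classK.strictMono.monotone.deriv_nonneg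

/-- For `ċ ≥ 0` the term `φ'(c) ċ` is nonnegative and `α(h) ≥ α(φ(c))`; the remaining velocity terms
are bounded by operator norms. -/
theorem le_z {kc : ℝ} (hx : x ∈ S.stateSpace)
    (hC : ‖S.C x.1 x.2‖ ≤ kc * ‖x.2‖) (hcdot : 0 ≤ K.cdot x) :
    K.ψ x.1 - K.η₁ x.1 * ‖x.2‖ - K.η₂ kc x.1 * ‖x.2‖ ^ 2 ≤ K.z x := by
  set g := gradient K.c x.1
  set r := ‖x.2‖ with hr
  have hr0 : 0 ≤ r := norm_nonneg _
  have h1 : -(‖fderiv ℝ (fderiv ℝ K.c) x.1‖ * r ^ 2)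
      ≤ fderiv ℝ (fderiv ℝ K.c) x.1 x.2 x.2 := by
    have h := (fderiv ℝ (fderiv ℝ K.c) x.1).le_opNorm₂ x.2 x.2
    rw [Real.norm_eq_abs] at h
    have := neg_le_of_abs_le h
    rw [← hr] at this
    linarith
  have h2 : inner ℝ g (S.Minv x.1 (S.C x.1 x.2 x.2))
      ≤ kc * ‖(innerSL ℝ g).comp (S.Minv x.1)‖ * r ^ 2 := by
    have h := ((innerSL ℝ g).comp (S.Minv x.1)).le_opNorm (S.C x.1 x.2 x.2)
    have h' : ‖S.C x.1 x.2 x.2‖ ≤ kc * r * r :=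
      ((S.C x.1 x.2).le_opNorm x.2).trans (mul_le_mul_of_nonneg_right hC hr0)
    calc _ ≤ ‖(innerSL ℝ g).comp (S.Minv x.1) (S.C x.1 x.2 x.2)‖ := le_abs_self _
      _ ≤ ‖(innerSL ℝ g).comp (S.Minv x.1)‖ * (kc * r * r) :=
        h.trans (mul_le_mul_of_nonneg_left h' (norm_nonneg _))
      _ = _ := by ring
  have h3 : inner ℝ g (S.Minv x.1 (K.Kd x.2)) ≤ K.η₁ x.1 * r :=
    (le_abs_self _).trans ((((innerSL ℝ g).comp (S.Minv x.1)).comp K.Kd).le_opNorm x.2)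
  have h4 : 0 ≤ deriv K.φ (K.c x.1) * K.cdot x := mul_nonneg (K.deriv_φ_nonneg _) hcdot
  have h5 : K.α (K.φ (K.c x.1)) ≤ K.α (K.h x) :=
    K.α_classK.strictMono.monotone (by rw [h]; linarith)
  rw [K.z_eq hx, ψ, η₂]
  linarith

/-- Hence at rest, where `ψ > 0`, the nominal control is active. This serves energy decay near rest
and the search for equilibria. -/
theorem z_eq_ψ (hx : x ∈ S.stateSpace) (hv : x.2 = 0) : K.z x = K.ψ x.1 := by
  rw [K.z_eq hx, ψ, h, cdot, hv]
  simp

theorem one_le_mul_norm {kc ρ : ℝ} (hx : x ∈ S.stateSpace) (hkc : 0 ≤ kc)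
    (hC : ‖S.C x.1 x.2‖ ≤ kc * ‖x.2‖) (hψ : 0 < K.ψ x.1) (hρ : K.gainAt kc x.1 ≤ ρ)
    (hz : K.z x < 0) (hcdot : 0 ≤ K.cdot x) : 1 ≤ ρ * ‖x.2‖ := by
  have h := K.le_z hx hC hcdot
  refine one_le_mul_of_positiveRoot_le hψ (norm_nonneg _) ?_ (norm_nonneg _) hρ
    (b := K.η₂ kc x.1) (a := K.η₁ x.1) (by linarith)
  rw [η₂]; positivity

/-- The correction of the nominal control does not add energy. -/
theorem inner_augControl_sub_nominal_nonpos {kc ρ : ℝ} (hx : x ∈ S.stateSpace) (hkc : 0 ≤ kc)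
    (hC : ‖S.C x.1 x.2‖ ≤ kc * ‖x.2‖) (hψ : 0 < K.ψ x.1) (hρ : K.gainAt kc x.1 ≤ ρ) :
    inner ℝ x.2 (K.augControl ρ x - K.nominal x) ≤ 0 := by
  rw [K.inner_augControl_sub_nominal]
  have ha := K.multiplier_nonpos hx
  rcases le_total 0 (K.z x) with hz | hz
  · simp [K.multiplier_eq_zero hz]
  rcases hz.eq_or_lt with hz | hz
  · simp [K.multiplier_eq_zero hz.ge]
  refine mul_nonpos_of_nonneg_of_nonpos (by linarith) ?_
  rcases le_total (K.cdot x) 0 with hc | hc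
  · rw [max_eq_right hc]; linarith
  · rw [max_eq_left hc]
    have h1 := K.one_le_mul_norm hx hkc hC hψ hρ hz hc
    have h2 : 1 ≤ ρ ^ 2 * ‖x.2‖ ^ 2 := by rw [← mul_pow]; exact one_le_pow₀ h1
    have h3 : 1 * K.cdot x ≤ ρ ^ 2 * ‖x.2‖ ^ 2 * K.cdot x := by gcongr
    linarith

end SafetyDesign

/-! ### Differential inequalities along curves. -/

section Comparison

theorem nonpos_of_hasDerivWithinAt_Ico_le_mul {w w' : ℝ → ℝ} {κ a b : ℝ}
    (hw : ∀ t ∈ Ico a b, HasDerivWithinAt w (w' t) (Ico a b) t)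
    (hle : ∀ t ∈ Ico a b, w' t ≤ κ * w t) (ha : w a ≤ 0) : ∀ t ∈ Ico a b, w t ≤ 0 := by
  intro t ht
  have h := le_gronwallBound_of_liminf_deriv_right_le (f := w) (f' := w') (δ := 0) (K := κ)
    (ε := 0) (a := a) (b := t)
    (fun s hs => ((hw s ⟨hs.1, hs.2.trans_lt ht.2⟩).mono
      (Icc_subset_Ico_right ht.2)).continuousWithinAt)
    (fun s hs r hr => by
      have hsb : s ∈ Ico a b := ⟨hs.1, hs.2.trans ht.2⟩
      have h1 : HasDerivWithinAt w (w' s) (Ici s) s := by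
        refine ((hw s hsb).mono (Ico_subset_Ico_left hs.1)).mono_of_mem_nhdsWithin ?_
        exact Ico_mem_nhdsGE hsb.2
      simpa [slope_def_field, div_eq_inv_mul] using h1.liminf_right_slope_le hr)
    ha (fun s hs => by simpa using hle s ⟨hs.1, hs.2.trans ht.2⟩) t (right_mem_Icc.2 ht.1)
  simpa [gronwallBound_ε0_δ0] using h

theorem hasDerivAt_min_zero_sq (s : ℝ) :
    HasDerivAt (fun r : ℝ => min r 0 ^ 2) (2 * min s 0) s := by
  rcases lt_trichotomy s 0 with h | rfl | h
  · rw [min_eq_left h.le]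
    have h1 : HasDerivAt (fun r : ℝ => r ^ 2) (2 * s) s := by simpa using hasDerivAt_pow 2 s
    refine h1.congr_of_eventuallyEq ?_
    filter_upwards [eventually_lt_nhds h] with r hr
    rw [min_eq_left hr.le]
  · rw [hasDerivAt_iff_isLittleO, Asymptotics.isLittleO_iff]
    intro ε hε
    filter_upwards [Metric.ball_mem_nhds (0 : ℝ) hε] with r hr
    have hr : |r| < ε := by simpa using hr
    have h1 : |min r 0| ≤ |r| := by
      rcases le_total r 0 with h | h
      · rw [min_eq_left h]
      · rw [min_eq_right h]; simp
    simp only [min_self, mul_zero, smul_zero, sub_zero, ne_eq, OfNat.ofNat_ne_zero,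
      not_false_eq_true, zero_pow, Real.norm_eq_abs, abs_pow]
    calc |min r 0| ^ 2 ≤ |r| ^ 2 := by gcongr
      _ = |r| * |r| := sq _
      _ ≤ ε * |r| := by gcongr
  · rw [min_eq_right h.le, mul_zero]
    refine (hasDerivAt_const s (0 : ℝ)).congr_of_eventuallyEq ?_
    filter_upwards [eventually_gt_nhds h] with r hr
    rw [min_eq_right hr.le]; simp

/-- Two quantities `c`, `h` with `ċ = h - φ(c)` and `ḣ ≥ -α(h) - B max ċ 0` remain nonnegative. -/
theorem min_zero_mul_deriv_add_le {c h c' h' p a B L : ℝ} (hB : 0 ≤ B) (hL : 0 ≤ L)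
    (hc' : c' = h - p) (hp : c < 0 → p ≤ 0 ∧ L * c ≤ p) (hp' : p < 0 → c < 0)
    (ha : h < 0 → a ≤ 0) (hh' : -a - B * max c' 0 ≤ h') :
    2 * min c 0 * c' + 2 * min h 0 * h' ≤ (1 + B * L) * (min c 0 ^ 2 + min h 0 ^ 2) := by
  have hm : min h 0 ≤ h := min_le_left _ _
  have hm0 : min h 0 ≤ 0 := min_le_right _ _
  have hmc0 : min c 0 ≤ 0 := min_le_right _ _
  have key : 2 * (min c 0 * min h 0) ≤ min c 0 ^ 2 + min h 0 ^ 2 := by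
    nlinarith [sq_nonneg (min c 0 - min h 0)]
  have h1 : min c 0 * c' ≤ min c 0 * min h 0 := by
    rcases le_or_gt 0 c with hc | hc
    · simp [min_eq_right hc]
    · rw [min_eq_left hc.le, hc']
      exact mul_le_mul_of_nonpos_left (by linarith [(hp hc).1]) hc.le
  have h2 : min h 0 * h' ≤ B * L * (min c 0 * min h 0) := by
    rcases le_or_gt 0 h with hh | hh
    · simp [min_eq_right hh]
    · rw [min_eq_left hh.le]
      -- Since `h < 0`, a positive `c' = h - p` forces `p < 0`, hence `c < 0` and `c' < -p ≤ -L c`.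
      have h3 : max c' 0 ≤ -L * min c 0 := by
        rcases le_or_gt c' 0 with hc | hc
        · rw [max_eq_right hc]; nlinarith
        · have hcneg : c < 0 := hp' (by linarith)
          rw [max_eq_left hc.le, min_eq_left hcneg.le]
          linarith [(hp hcneg).2]
      have h4 : B * max c' 0 ≤ B * (-L * min c 0) := mul_le_mul_of_nonneg_left h3 hB
      have h5 : B * (L * min c 0) ≤ h' := by linarith [ha hh]
      calc h * h' ≤ h * (B * (L * min c 0)) := mul_le_mul_of_nonpos_left h5 hh.le
        _ = _ := by ring
  have hBL : 0 ≤ B * L := mul_nonneg hB hL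
  nlinarith [mul_le_mul_of_nonneg_left key hBL]

variable {X : Type*} [NormedAddCommGroup X] [NormedSpace ℝ X]

theorem IsIntegralCurveOn.exists_forall_Ico {F : X → X} {x : ℝ → X} {a b : ℝ} (hab : a < b)
    (hx : IsIntegralCurveOn x (fun _ => F) (Ico a b)) {p : X → Prop} (hp : ∀ᶠ y in 𝓝 (x a), p y) :
    ∃ d, a < d ∧ d ≤ b ∧ ∀ t ∈ Ico a d, p (x t) := by
  have h1 : ∀ᶠ t in 𝓝[Ico a b] a, p (x t) := (hx.continuousOn a ⟨le_rfl, hab⟩).eventually hp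
  rw [nhdsWithin_Ico_eq_nhdsGE hab] at h1
  obtain ⟨c, hac, hc⟩ := mem_nhdsGE_iff_exists_Ico_subset.1 h1
  exact ⟨min b c, lt_min hab hac, min_le_left _ _,
    fun t ht => hc ⟨ht.1, ht.2.trans_le (min_le_right _ _)⟩⟩

theorem IsIntegralCurveOn.hasDerivWithinAt_comp {F : X → X} {x : ℝ → X} {I : Set ℝ}
    (hx : IsIntegralCurveOn x (fun _ => F) I) {V : X → ℝ} {t : ℝ} (ht : t ∈ I)
    (hV : DifferentiableAt ℝ V (x t)) :
    HasDerivWithinAt (V ∘ x) (fderiv ℝ V (x t) (F (x t))) I t :=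
  hV.hasFDerivAt.comp_hasDerivWithinAt t (hx t ht)

theorem IsIntegralCurveOn.eventually_le_of_fderiv_nonpos {F : X → X} {x : ℝ → X} {a b : ℝ}
    (hab : a < b) (hx : IsIntegralCurveOn x (fun _ => F) (Ico a b)) {V : X → ℝ}
    (hV : ∀ᶠ y in 𝓝 (x a), DifferentiableAt ℝ V y ∧ fderiv ℝ V y (F y) ≤ 0) :
    ∀ᶠ t in 𝓝[>] a, V (x t) ≤ V (x a) := by
  obtain ⟨d, had, hdb, hd⟩ := hx.exists_forall_Ico hab hV
  have hx' := hx.mono (Ico_subset_Ico_right hdb)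
  have h := nonpos_of_hasDerivWithinAt_Ico_le_mul (w := fun t => V (x t) - V (x a)) (κ := 0)
    (fun t ht => (hx'.hasDerivWithinAt_comp ht (hd t ht).1).sub_const _)
    (fun t ht => by simpa using (hd t ht).2) (by simp)
  filter_upwards [Ioo_mem_nhdsGT had] with t ht
  linarith [h t ⟨ht.1.le, ht.2⟩]

end Comparison

/-- At `s₀ = 0` a local Lipschitz constant of `φ` serves as `L`; for `s₀ > 0` no nearby `s` is
negative. -/
theorem IsExtendedClassK.exists_mul_le {φ : ℝ → ℝ} (hφ : IsExtendedClassK φ)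
    (hφ1 : ContDiff ℝ 1 φ) {s₀ : ℝ} (hs₀ : 0 ≤ s₀) :
    ∃ L, 0 ≤ L ∧ ∀ᶠ s in 𝓝 s₀, s < 0 → L * s ≤ φ s := by
  rcases hs₀.eq_or_lt with rfl | h
  · obtain ⟨L, t, ht, hL⟩ := hφ1.locallyLipschitz 0
    refine ⟨L, L.2, ?_⟩
    filter_upwards [ht] with s hs hneg
    have h1 := hL.dist_le_mul s hs 0 (mem_of_mem_nhds ht)
    rw [hφ.map_zero, dist_zero_right, dist_zero_right, Real.norm_eq_abs, Real.norm_eq_abs,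
      abs_of_neg hneg] at h1
    linarith [neg_abs_le (φ s)]
  · exact ⟨0, le_rfl, (eventually_gt_nhds h).mono fun s hs hneg => absurd hs hneg.not_gt⟩

theorem IsExtendedClassK.neg_iff {φ : ℝ → ℝ} (hφ : IsExtendedClassK φ) {s : ℝ} :
    φ s < 0 ↔ s < 0 := by
  have := hφ.strictMono.lt_iff_lt (a := s) (b := 0)
  rwa [hφ.map_zero] at this

theorem IsExtendedClassK.pos_iff {φ : ℝ → ℝ} (hφ : IsExtendedClassK φ) {s : ℝ} :
    0 < φ s ↔ 0 < s := by
  have := hφ.strictMono.lt_iff_lt (a := 0) (b := s)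
  rwa [hφ.map_zero] at this

/-! ### Local invariance, compactness and position of the origin. -/

namespace SafetyDesign

variable {n : ℕ} {S : MechanicalSystem n} (K : SafetyDesign S) {q : Vec n} {x : Vec n × Vec n}

/-- The penalty `min(c,0)² + min(h,0)²` starts at zero and Grönwall keeps it there. The estimate
holds on a full neighbourhood, since the curve is not yet known to stay in the safe set. -/
theorem eventually_mem_safeSet (ρ : ℝ) {x : ℝ → Vec n × Vec n} {a b : ℝ} (hab : a < b)
    (hx : IsIntegralCurveOn x (fun _ => K.closedLoop ρ) (Ico a b)) (ha : x a ∈ K.safeSet)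
    (hreg : x a ∈ K.regularRegion) : ∀ᶠ t in 𝓝[>] a, x t ∈ K.safeSet := by
  set e : Vec n × Vec n → ℝ := fun y =>
    ρ ^ 2 * K.multiplier y * inner ℝ (gradient K.c y.1) (S.Minv y.1 y.2) with he
  have hU := K.isOpen_regularRegion.mem_nhds hreg
  have hecont : ContinuousOn e K.regularRegion := by
    have hfst := continuousOn_fst (s := K.regularRegion)
    have hmaps := S.mapsTo_fst.mono_left K.regularRegion_subset
    exact (continuousOn_const.mul K.continuousOn_multiplier).mul
      ((K.continuousOn_gradient.comp hfst hmaps).inner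
        ((S.continuousOn_Minv.comp hfst hmaps).clm_apply continuousOn_snd))
  set B := |e (x a)| + 1 with hB
  have hB0 : 0 ≤ B := by positivity
  have hbound : ∀ᶠ y in 𝓝 (x a), |e y| < B :=
    (hecont.continuousAt hU).abs.eventually_lt_const (lt_add_one _)
  obtain ⟨L, hL0, hL⟩ := K.φ_classK.exists_mul_le K.φ_contDiff ha.1.2
  have hL' : ∀ᶠ y in 𝓝 (x a), K.c y.1 < 0 → L * K.c y.1 ≤ K.φ (K.c y.1) := by
    have hc : ContinuousAt (fun y : Vec n × Vec n => K.c y.1) (x a) :=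
      ContinuousAt.comp (K.continuousOn_c.continuousAt (S.isOpen_Q₀.mem_nhds ha.1.1))
        continuousAt_fst
    exact hc.eventually hL
  obtain ⟨d, had, hdb, hd⟩ := hx.exists_forall_Ico hab
    ((K.isOpen_regularRegion.eventually_mem hreg).and (hbound.and hL'))
  have hx' := hx.mono (Ico_subset_Ico_right hdb)
  have hderiv : ∀ t ∈ Ico a d, HasDerivWithinAt
      (fun t => min (K.c (x t).1) 0 ^ 2 + min (K.h (x t)) 0 ^ 2)
      (2 * min (K.c (x t).1) 0 * K.cdot (x t) + 2 * min (K.h (x t)) 0 *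
        fderiv ℝ K.h (x t) (K.closedLoop ρ (x t))) (Ico a d) t := by
    intro t ht
    have hst := (hd t ht).1.1
    have h1 : HasDerivWithinAt (fun t => (x t).1) (x t).2 (Ico a d) t := by
      have := hx' t ht
      simp only [closedLoop_eq] at this
      exact this.fst
    have h2 : HasDerivWithinAt (fun t => K.c (x t).1) (K.cdot (x t)) (Ico a d) t := by
      rw [cdot_eq]
      exact (K.differentiableAt_c (S.mapsTo_fst hst)).hasFDerivAt.comp_hasDerivWithinAt t h1
    have h3 := hx'.hasDerivWithinAt_comp ht (K.hasFDerivAt_h hst).differentiableAt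
    exact ((hasDerivAt_min_zero_sq _).comp_hasDerivWithinAt t h2).add
      ((hasDerivAt_min_zero_sq _).comp_hasDerivWithinAt t h3)
  have hle := nonpos_of_hasDerivWithinAt_Ico_le_mul hderiv (κ := 1 + B * L) (fun t ht => by
    obtain ⟨hr, hb, hl⟩ := hd t ht
    refine min_zero_mul_deriv_add_le (p := K.φ (K.c (x t).1)) (a := K.α (K.h (x t))) hB0 hL0
      (by rw [h]; ring) (fun hc => ⟨(K.φ_classK.neg_iff.2 hc).le, hl hc⟩) K.φ_classK.neg_iff.1
      (fun hh => (K.α_classK.neg_iff.2 hh).le) ?_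
    rw [K.fderiv_h_closedLoop ρ hr]
    have h1 : -B * max (K.cdot (x t)) 0 ≤ e (x t) * max (K.cdot (x t)) 0 :=
      mul_le_mul_of_nonneg_right (abs_lt.1 hb).1.le (le_max_right _ _)
    have h2 := le_max_right (K.z (x t)) 0
    simp only [he] at h1
    linarith) (by simp [min_eq_right ha.1.2, min_eq_right ha.2])
  filter_upwards [Ioo_mem_nhdsGT had] with t ht
  have ht' : t ∈ Ico a d := ⟨ht.1.le, ht.2⟩
  have h0 := hle t ht'
  have h1 : min (K.c (x t).1) 0 = 0 := by nlinarith [sq_nonneg (min (K.h (x t)) 0)]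
  have h2 : min (K.h (x t)) 0 = 0 := by nlinarith [sq_nonneg (min (K.c (x t).1) 0)]
  exact ⟨⟨S.mapsTo_fst (hd t ht').1.1, min_eq_right_iff.1 h1⟩, min_eq_right_iff.1 h2⟩

theorem fderiv_energy_closedLoop (ρ : ℝ) (hx : x ∈ S.stateSpace) :
    fderiv ℝ K.energy x (K.closedLoop ρ x)
      = -inner ℝ x.2 (K.Kd x.2) + inner ℝ x.2 (K.augControl ρ x - K.nominal x) := by
  rw [K.closedLoop_eq_portedLoop, K.fderiv_energy_portedLoop ρ hx, inner_neg_left,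
    real_inner_comm]

theorem continuousOn_fderiv_energy_closedLoop (ρ : ℝ) :
    ContinuousOn (fun x => fderiv ℝ K.energy x (K.closedLoop ρ x)) K.regularRegion :=
  ((K.contDiffOn_energy.continuousOn_fderiv_of_isOpen S.isOpen_stateSpace le_rfl).mono
    K.regularRegion_subset).clm_apply (K.continuousOn_closedLoop ρ)

/-- Invariance needs decay around `x`, also outside the set where the gain condition holds. If `v =
0`, then `z > 0` nearby and the control is nominal there; if `v ≠ 0`, the decay at `x` is strict and
persists by continuity. -/
theorem eventually_fderiv_energy_nonpos {kc ρ : ℝ} (hx : x ∈ K.regularRegion) (hkc : 0 ≤ kc)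
    (hC : ‖S.C x.1 x.2‖ ≤ kc * ‖x.2‖) (hψ : 0 < K.ψ x.1) (hρ : K.gainAt kc x.1 ≤ ρ) :
    ∀ᶠ y in 𝓝 x, fderiv ℝ K.energy y (K.closedLoop ρ y) ≤ 0 := by
  have hU := K.isOpen_regularRegion.mem_nhds hx
  have hst := S.isOpen_stateSpace.mem_nhds hx.1
  rcases eq_or_ne x.2 0 with hv | hv
  · have hz : 0 < K.z x := by rwa [K.z_eq_ψ hx.1 hv]
    filter_upwards [(K.continuousOn_z.continuousAt hst).eventually_const_lt hz, hst]
      with y hy hyS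
    rw [K.fderiv_energy_closedLoop ρ hyS, K.inner_augControl_sub_nominal,
      K.multiplier_eq_zero hy.le]
    have := K.Kd_posDef.inner_nonneg y.2
    linarith
  · have hneg : fderiv ℝ K.energy x (K.closedLoop ρ x) < 0 := by
      rw [K.fderiv_energy_closedLoop ρ hx.1]
      have h1 := K.Kd_posDef.pos _ hv
      have h2 := K.inner_augControl_sub_nominal_nonpos hx.1 hkc hC hψ hρ
      linarith
    exact (((K.continuousOn_fderiv_energy_closedLoop ρ).continuousAt hU).eventually_lt_const
      hneg).mono fun y hy => hy.le

theorem potential_le_energy (hx : x ∈ S.stateSpace) :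
    (1 / 2) * inner ℝ x.1 (K.Kp x.1) ≤ K.energy x := by
  have := (S.M_posDef _ (S.mapsTo_fst hx)).inner_nonneg x.2
  rw [energy]; linarith

theorem energy_nonneg (hx : x ∈ S.stateSpace) : 0 ≤ K.energy x := by
  have := K.potential_le_energy hx
  have := K.Kp_posDef.inner_nonneg x.1
  linarith

theorem energy_zero : K.energy 0 = 0 := by simp [energy]

theorem eq_zero_of_energy_eq_zero (hx : x ∈ S.stateSpace) (h : K.energy x = 0) : x = 0 := by
  have h1 := (S.M_posDef _ (S.mapsTo_fst hx)).inner_nonneg x.2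
  have h2 := K.Kp_posDef.inner_nonneg x.1
  rw [energy] at h
  exact Prod.ext (K.Kp_posDef.eq_zero_of_inner_nonpos (by linarith))
    ((S.M_posDef _ (S.mapsTo_fst hx)).eq_zero_of_inner_nonpos (by linarith))

theorem fst_mem_of_mem {ν : ℝ} (hx : x ∈ K.Γ ν ∩ K.safeSet) : x.1 ∈ K.P ν ∩ K.Q :=
  ⟨⟨hx.2.1.1, (K.potential_le_energy hx.1.1).trans hx.1.2⟩, hx.2.1⟩

/-- If `∇c = 0` then `L_g h = 0`, which rules out the first alternative; the second gives `∇h = 0`,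
so `z = α(h) = α(φ(c)) = ψ > 0`. -/
theorem mem_regularRegion {E : Set (Vec n × Vec n)} (hE_safe : K.safeSet ⊆ E)
    (hreg : BarrierRegular K.h (S.lieInput K.h) K.safeSet E S.stateSpace)
    (hx : x ∈ K.safeSet) (hψ : 0 < K.ψ x.1) : x ∈ K.regularRegion := by
  have hq := hx.1.1
  have hxS : x ∈ S.stateSpace := S.mem_stateSpace.2 hq
  refine ⟨hxS, or_iff_not_imp_right.2 fun hg => ?_⟩
  have hgrad := K.gradient_eq_zero_of_gradNormSq hq (not_not.1 hg)
  have hLg : S.lieInput K.h x = 0 := by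
    ext w
    have : S.lieInput K.h x w = fderiv ℝ K.h x (0, S.Minv x.1 w) := rfl
    rw [this, K.fderiv_h_apply hxS, ← inner_gradient_left, hgrad]
    simp
  have hfd : fderiv ℝ K.h x = 0 := by
    rcases hreg with h | h
    · exact absurd hLg (h x ⟨hxS, hE_safe hx⟩)
    · exact (h x ⟨hxS, hE_safe hx⟩ hLg).2
  have hz : K.z x = K.ψ x.1 := by
    rw [z, hLg, MechanicalSystem.lieDrift, hfd, ψ, hgrad, h, cdot, hgrad]
    simp
  rwa [hz]

/-- Configurations are compact by assumption; velocities are bounded because `M` is uniformly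
coercive over them, by minimising `vᵀMv` on the unit sphere bundle. -/
theorem isCompact_inter_safeSet {ν : ℝ} (hcompact : IsCompact (K.P ν ∩ K.Q)) :
    IsCompact (K.Γ ν ∩ K.safeSet) := by
  obtain ⟨m, hm, hmin⟩ : ∃ m > 0, ∀ q ∈ K.P ν ∩ K.Q, ∀ v : Vec n,
      m * ‖v‖ ^ 2 ≤ inner ℝ v (S.M q v) := by
    set T := (K.P ν ∩ K.Q) ×ˢ Metric.sphere (0 : Vec n) 1 with hT
    have hTc : IsCompact T := hcompact.prod (isCompact_sphere 0 1)
    have hcont : ContinuousOn (fun y : Vec n × Vec n => inner ℝ y.2 (S.M y.1 y.2)) T :=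
      continuousOn_snd.inner ((S.M_contDiffOn.continuousOn.comp continuousOn_fst
        fun y hy => hy.1.1.1).clm_apply continuousOn_snd)
    rcases T.eq_empty_or_nonempty with he | hne
    · refine ⟨1, one_pos, fun q hq v => ?_⟩
      rcases eq_or_ne v 0 with rfl | hv
      · simp
      · exfalso
        have : (q, ‖v‖⁻¹ • v) ∈ T := ⟨hq, by
          simp [norm_smul, inv_mul_cancel₀ (norm_ne_zero_iff.2 hv)]⟩
        rw [he] at this
        exact this
    · obtain ⟨p, hp, hpmin⟩ := hTc.exists_isMinOn hne hcont
      have hp2 : p.2 ≠ 0 := fun h0 => by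
        have := hp.2
        rw [h0] at this
        simp at this
      refine ⟨_, (S.M_posDef p.1 hp.1.1.1).pos p.2 hp2, fun q hq v => ?_⟩
      rcases eq_or_ne v 0 with rfl | hv
      · simp
      · have hv' := norm_ne_zero_iff.2 hv
        have hmem : (q, ‖v‖⁻¹ • v) ∈ T := ⟨hq, by
          simp [norm_smul, inv_mul_cancel₀ hv']⟩
        have h1 := hpmin hmem
        simp only [mem_ofPred_eq, map_smul, real_inner_smul_left, real_inner_smul_right] at h1
        calc _ ≤ ‖v‖⁻¹ * (‖v‖⁻¹ * inner ℝ v (S.M q v)) * ‖v‖ ^ 2 := by gcongr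
          _ = _ := by field_simp
  set R := √(2 * ν / m) with hR
  set T := (K.P ν ∩ K.Q) ×ˢ Metric.closedBall (0 : Vec n) R with hT
  have hTc : IsCompact T := hcompact.prod (isCompact_closedBall 0 R)
  have hTS : T ⊆ S.stateSpace := fun y hy => S.mem_stateSpace.2 hy.1.1.1
  have h1 := (K.contDiffOn_energy.continuousOn.mono hTS).preimage_isClosed_of_isClosed
    hTc.isClosed (isClosed_Iic (a := ν))
  have h2 := (K.continuousOn_h.mono hTS).preimage_isClosed_of_isClosed
    hTc.isClosed (isClosed_Ici (a := (0 : ℝ)))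
  have hsub : K.Γ ν ∩ K.safeSet ⊆ T := by
    intro y hy
    have hy1 := K.fst_mem_of_mem hy
    refine ⟨hy1, ?_⟩
    rw [mem_closedBall_zero_iff, hR]
    refine Real.le_sqrt_of_sq_le ?_
    rw [le_div_iff₀ hm]
    have h3 := hmin _ hy1 y.2
    have h4 := K.Kp_posDef.inner_nonneg y.1
    have h5 := hy.1.2
    rw [energy] at h5
    linarith
  have heq : K.Γ ν ∩ K.safeSet = T ∩ K.energy ⁻¹' Iic ν ∩ (T ∩ K.h ⁻¹' Ici 0) := by
    ext y
    exact ⟨fun hy => ⟨⟨hsub hy, hy.1.2⟩, hsub hy, hy.2.2⟩,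
      fun hy => ⟨⟨hTS hy.1.1, hy.1.2⟩, hy.1.1.1.2, hy.2.2⟩⟩
  rw [heq]
  exact hTc.of_isClosed_subset (h1.inter h2) fun y hy => hy.1.1

/-- A nonzero minimiser of `qᵀK_p q` on the compact set could be moved along `-M⁻¹K_p q`, decreasing
the potential without leaving the set. -/
theorem zero_mem_of_ψ_pos {ν : ℝ} (hcompact : IsCompact (K.P ν ∩ K.Q))
    (hne : (K.P ν ∩ K.Q).Nonempty) (hψ : ∀ q ∈ K.P ν ∩ K.Q, 0 < K.ψ q) :
    (0 : Vec n) ∈ K.P ν ∩ K.Q := by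
  set W : Vec n → ℝ := fun q => inner ℝ q (K.Kp q) with hW
  have hWd : ∀ q, HasFDerivAt W _ q := fun q =>
    (hasFDerivAt_id q).inner ℝ (K.Kp.hasFDerivAt (x := q))
  obtain ⟨p, hp, hmin⟩ := hcompact.exists_isMinOn hne
    (f := W) (fun q _ => (hWd q).continuousAt.continuousWithinAt)
  rcases eq_or_ne p 0 with rfl | hp0
  · exact hp
  exfalso
  have hpQ := hp.1.1
  have hKp : K.Kp p ≠ 0 := fun h0 => hp0 (K.Kp_posDef.eq_zero_of_inner_nonpos (by
    rw [h0, inner_zero_right]))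
  set w := -S.Minv p (K.Kp p) with hw
  have hline : HasDerivAt (fun t : ℝ => p + t • w) w 0 := by
    simpa using ((hasDerivAt_id (0 : ℝ)).smul_const w).const_add p
  have hline0 : p + (0 : ℝ) • w = p := by simp
  have hcontl : Tendsto (fun t : ℝ => p + t • w) (𝓝 0) (𝓝 p) := by
    simpa using hline.continuousAt.tendsto
  have hWline : HasDerivAt (fun t : ℝ => W (p + t • w)) (2 * inner ℝ (K.Kp p) w) 0 := by
    have h1 : HasFDerivAt W _ (p + (0 : ℝ) • w) := hWd _
    have h2 := h1.comp_hasDerivAt 0 hline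
    have h3 := K.Kp_posDef.symm p w
    refine h2.congr_deriv ?_
    simp
    rw [← h3, real_inner_comm (K.Kp p) w]
    ring
  have hneg : 2 * inner ℝ (K.Kp p) w < 0 := by
    have := S.Minv_pos hpQ hKp
    rw [hw, inner_neg_right]; linarith
  have hWdec : ∀ᶠ t in 𝓝[>] (0 : ℝ), W (p + t • w) < W p := by
    have := hWline.hasDerivWithinAt.limsup_slope_le' (s := Ioi 0) self_notMem_Ioi hneg
    filter_upwards [this, self_mem_nhdsWithin] with t ht ht0
    rw [slope_def_field, sub_zero, hline0, div_neg_iff] at ht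
    have ht0 : (0 : ℝ) < t := ht0
    rcases ht with h | h <;> linarith
  have hQ₀ : ∀ᶠ t in 𝓝[>] (0 : ℝ), p + t • w ∈ S.Q₀ :=
    (hcontl.eventually (S.isOpen_Q₀.mem_nhds hpQ)).filter_mono nhdsWithin_le_nhds
  have hcpos : ∀ᶠ t in 𝓝[>] (0 : ℝ), 0 ≤ K.c (p + t • w) := by
    -- On the boundary `c p = 0` the term `α(φ(0))` vanishes, so `ψ p = ∇cᵀw > 0` and `c` increases
    -- along `w`; off it, continuity suffices.
    rcases hp.2.2.eq_or_lt with hc | hc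
    · have hcline : HasDerivAt (fun t : ℝ => -K.c (p + t • w)) (-inner ℝ (gradient K.c p) w) 0 := by
        have h1 : HasFDerivAt K.c (fderiv ℝ K.c p) (p + (0 : ℝ) • w) := by
          rw [hline0]; exact (K.differentiableAt_c hpQ).hasFDerivAt
        rw [inner_gradient_left]
        exact (h1.comp_hasDerivAt 0 hline).neg
      have hpos : -inner ℝ (gradient K.c p) w < 0 := by
        have h1 := hψ p hp
        rw [ψ, ← hc, K.φ_classK.map_zero, K.α_classK.map_zero] at h1
        rw [hw, inner_neg_right]; linarith
      have := hcline.hasDerivWithinAt.limsup_slope_le' (s := Ioi 0) self_notMem_Ioi hpos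
      filter_upwards [this, self_mem_nhdsWithin] with t ht ht0
      rw [slope_def_field, sub_zero, hline0, ← hc, div_neg_iff] at ht
      have ht0 : (0 : ℝ) < t := ht0
      rcases ht with h | h <;> linarith
    · have : ContinuousAt K.c p := (K.differentiableAt_c hpQ).continuousAt
      have h1 := hcontl.eventually (this.eventually_const_lt hc)
      exact (h1.mono fun t ht => ht.le).filter_mono nhdsWithin_le_nhds
  obtain ⟨t, h1, h2, h3⟩ := (hWdec.and (hQ₀.and hcpos)).exists
  have hmem : p + t • w ∈ K.P ν ∩ K.Q := by
    refine ⟨⟨h2, ?_⟩, h2, h3⟩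
    have := hp.1.2
    change (1 / 2) * W (p + t • w) ≤ ν
    change (1 / 2) * W p ≤ ν at this
    linarith
  exact absurd (hmin hmem) (not_le.2 h1)

/-- At the origin `ψ` reduces to `α(φ(c 0))`, so `c` and `h` are strictly positive there. -/
theorem inter_safeSet_mem_nhds_zero {ν : ℝ} (hν : 0 < ν) (h0 : (0 : Vec n) ∈ K.P ν ∩ K.Q)
    (hψ : 0 < K.ψ 0) : K.Γ ν ∩ K.safeSet ∈ 𝓝 (0 : Vec n × Vec n) := by
  have hS : S.stateSpace ∈ 𝓝 (0 : Vec n × Vec n) :=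
    S.isOpen_stateSpace.mem_nhds (S.mem_stateSpace.2 h0.1.1)
  have hφ : 0 < K.φ (K.c 0) := by
    rw [ψ, map_zero, map_zero, inner_zero_right, neg_zero, zero_add] at hψ
    exact K.α_classK.pos_iff.1 hψ
  have hc : 0 < K.c (0 : Vec n × Vec n).1 := K.φ_classK.pos_iff.1 hφ
  have hh : 0 < K.h 0 := by
    simp only [h, cdot, Prod.snd_zero, inner_zero_right, zero_add]
    exact hφ
  have hcc : ContinuousAt (fun y : Vec n × Vec n => K.c y.1) 0 :=
    (K.continuousOn_c.comp continuousOn_fst S.mapsTo_fst).continuousAt hS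
  filter_upwards [hS, hcc.eventually_const_lt hc,
    (K.continuousOn_h.continuousAt hS).eventually_const_lt hh,
    (K.contDiffOn_energy.continuousOn.continuousAt hS).eventually_lt_const
      (show K.energy 0 < ν by rwa [K.energy_zero])] with y h1 h2 h3 h4
  exact ⟨⟨h1, h4.le⟩, ⟨S.mapsTo_fst h1, h2.le⟩, h3.le⟩

end SafetyDesign

/-! ### Invariance of `Γ_ν ∩ 𝒞`, equilibria and convergence. -/

namespace SafetyDesign

variable {n : ℕ} {S : MechanicalSystem n} (K : SafetyDesign S)

theorem locallyForwardInvariant {ν kc ρ : ℝ} (hkc : 0 ≤ kc)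
    (hreg : K.Γ ν ∩ K.safeSet ⊆ K.regularRegion)
    (hC : ∀ q ∈ K.P ν ∩ K.Q, ∀ v : Vec n, ‖S.C q v‖ ≤ kc * ‖v‖)
    (hψ : ∀ q ∈ K.P ν ∩ K.Q, 0 < K.ψ q) (hρ : ∀ q ∈ K.P ν ∩ K.Q, K.gainAt kc q ≤ ρ) :
    LocallyForwardInvariant (K.closedLoop ρ) (K.Γ ν ∩ K.safeSet) := by
  intro x a b hab hx ha
  have hq := K.fst_mem_of_mem ha
  have hst := S.isOpen_stateSpace.mem_nhds ha.1.1
  have hV := hx.eventually_le_of_fderiv_nonpos (V := K.energy) hab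
    (((S.isOpen_stateSpace.eventually_mem ha.1.1).mono
      fun y hy => K.differentiableAt_energy hy).and
      (K.eventually_fderiv_energy_nonpos (hreg ha) hkc (hC _ hq _) (hψ _ hq) (hρ _ hq)))
  filter_upwards [hV, K.eventually_mem_safeSet ρ hab hx ha.2 (hreg ha)] with t h1 h2
  exact ⟨⟨S.mem_stateSpace.2 h2.1.1, h1.trans ha.1.2⟩, h2⟩

theorem fderiv_energy_closedLoop_le {ν kc ρ : ℝ} (hkc : 0 ≤ kc)
    (hC : ∀ q ∈ K.P ν ∩ K.Q, ∀ v : Vec n, ‖S.C q v‖ ≤ kc * ‖v‖)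
    (hψ : ∀ q ∈ K.P ν ∩ K.Q, 0 < K.ψ q) (hρ : ∀ q ∈ K.P ν ∩ K.Q, K.gainAt kc q ≤ ρ)
    {x : Vec n × Vec n} (hx : x ∈ K.Γ ν ∩ K.safeSet) :
    fderiv ℝ K.energy x (K.closedLoop ρ x) ≤ -inner ℝ x.2 (K.Kd x.2) := by
  have hq := K.fst_mem_of_mem hx
  have := K.inner_augControl_sub_nominal_nonpos hx.1.1 hkc (hC _ hq _) (hψ _ hq) (hρ _ hq)
  rw [K.fderiv_energy_closedLoop ρ hx.1.1]
  linarith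

/-- An equilibrium has `v = 0`, so the nominal control acts and the force balance is `K_p q = 0`:
the filter creates no spurious equilibria. -/
theorem eq_zero_of_closedLoop_eq_zero {ρ : ℝ} {x : Vec n × Vec n} (hx : x ∈ S.stateSpace)
    (hψ : 0 < K.ψ x.1) (h : K.closedLoop ρ x = 0) : x = 0 := by
  have hq := S.mapsTo_fst hx
  rw [closedLoop_eq] at h
  have hv : x.2 = 0 := congrArg Prod.fst h
  have hz : 0 ≤ K.z x := by rw [K.z_eq_ψ hx hv]; exact hψ.le
  have h2 := S.Minv_eq_zero hq (congrArg Prod.snd h)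
  rw [augControl, if_pos hz, nominal, hv, map_zero, map_zero] at h2
  have h3 : K.Kp x.1 = 0 := by
    have : -(0 : Vec n) - S.τg x.1 + (S.τg x.1 - K.Kp x.1 - 0) = -K.Kp x.1 := by abel
    rw [this] at h2
    exact neg_eq_zero.1 h2
  exact Prod.ext (K.Kp_posDef.eq_zero_of_inner_nonpos (by rw [h3, inner_zero_right])) hv

theorem closedLoop_zero {ρ : ℝ} (h0 : (0 : Vec n) ∈ S.Q₀) (hψ : 0 < K.ψ 0) :
    K.closedLoop ρ 0 = 0 := by
  have hz : 0 ≤ K.z 0 := by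
    rw [K.z_eq_ψ (S.mem_stateSpace.2 h0) rfl]; exact hψ.le
  rw [closedLoop_eq, augControl, if_pos hz, nominal]
  simp

/-- The energy does not increase along solutions of the closed loop in `Γ_ν ∩ 𝒞`. -/
theorem antitoneOn_energy_comp {ρ : ℝ} {A : Set (Vec n × Vec n)} (hAS : A ⊆ S.stateSpace)
    (hdiss : ∀ y ∈ A, fderiv ℝ K.energy y (K.closedLoop ρ y) ≤ 0) {x : ℝ → Vec n × Vec n}
    {I : Set ℝ} (hI : Convex ℝ I) (hx : IsIntegralCurveOn x (fun _ => K.closedLoop ρ) I)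
    (hxA : ∀ t ∈ I, x t ∈ A) : AntitoneOn (K.energy ∘ x) I := by
  have hd : ∀ t ∈ I, HasDerivWithinAt (K.energy ∘ x)
      (fderiv ℝ K.energy (x t) (K.closedLoop ρ (x t))) I t := fun t ht =>
    hx.hasDerivWithinAt_comp ht (K.differentiableAt_energy (hAS (hxA t ht)))
  exact antitoneOn_of_hasDerivWithinAt_nonpos hI (fun t ht => (hd t ht).continuousWithinAt)
    (fun t ht => (hd t (interior_subset ht)).mono interior_subset)
    fun t ht => hdiss _ (hxA t (interior_subset ht))

theorem tendsto_zero_of_isIntegralCurveOn {ρ : ℝ} {A : Set (Vec n × Vec n)} (hA : IsCompact A)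
    (hAU : A ⊆ K.regularRegion)
    (hdiss : ∀ y ∈ A, fderiv ℝ K.energy y (K.closedLoop ρ y) ≤ -inner ℝ y.2 (K.Kd y.2))
    (hψ : ∀ y ∈ A, 0 < K.ψ y.1) {x : ℝ → Vec n × Vec n}
    (hx : IsIntegralCurveOn x (fun _ => K.closedLoop ρ) (Ici 0)) (hxA : ∀ t, 0 ≤ t → x t ∈ A) :
    Tendsto x atTop (𝓝 0) := by
  have hAS := hAU.trans K.regularRegion_subset
  have hF := (K.continuousOn_closedLoop ρ).mono hAU
  have hG := (K.continuousOn_fderiv_energy_closedLoop ρ).mono hAU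
  obtain ⟨B, hB⟩ := hA.exists_nnreal_bound_of_continuousOn hF
  have hlip := lipschitzOnWith_of_isIntegralCurveOn (convex_Ici 0) hx hxA hB
  have hxu : UniformContinuousOn x (Ici 0) := hlip.uniformContinuousOn
  have hev : ∀ᶠ t in atTop, x t ∈ A := (eventually_ge_atTop 0).mono hxA
  have hanti := K.antitoneOn_energy_comp hAS (fun y hy => (hdiss y hy).trans
    (neg_nonpos.2 (K.Kd_posDef.inner_nonneg _))) (convex_Ici 0) hx hxA
  have hVlim : ∃ l, Tendsto (K.energy ∘ x) atTop (𝓝 l) := by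
    have h1 : Antitone fun t => (K.energy ∘ x) (max t 0) := fun s t hst =>
      hanti (le_max_right s 0) (le_max_right t 0) (max_le_max_right 0 hst)
    have h2 : BddBelow (range fun t => (K.energy ∘ x) (max t 0)) :=
      ⟨0, by rintro _ ⟨t, rfl⟩; exact K.energy_nonneg (hAS (hxA _ (le_max_right t 0)))⟩
    refine ⟨_, (tendsto_atTop_ciInf h1 h2).congr' ?_⟩
    filter_upwards [eventually_ge_atTop (0 : ℝ)] with t ht
    rw [max_eq_left ht]
  obtain ⟨l, hl⟩ := hVlim
  have hV' := tendsto_zero_of_uniformContinuousOn_deriv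
    (fun t ht => hx.hasDerivWithinAt_comp ht (K.differentiableAt_energy (hAS (hxA t ht))))
    ((hA.uniformContinuousOn_of_continuous hG).comp hxu hxA) hl
  have hdamp : Tendsto (fun t => inner ℝ (x t).2 (K.Kd (x t).2)) atTop (𝓝 0) := by
    refine tendsto_of_tendsto_of_tendsto_of_le_of_le' tendsto_const_nhds
      (by simpa using hV'.neg) (Eventually.of_forall fun t => K.Kd_posDef.inner_nonneg _) ?_
    filter_upwards [hev] with t ht
    linarith [hdiss _ ht]
  have hv : Tendsto (fun t => (x t).2) atTop (𝓝 0) :=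
    (hA.image continuous_snd).tendsto_of_tendsto_comp (G := fun v => inner ℝ v (K.Kd v))
      (continuous_id.inner K.Kd.continuous).continuousOn
      (fun v _ h => K.Kd_posDef.eq_zero_of_inner_nonpos h.le)
      (hev.mono fun t ht => mem_image_of_mem _ ht) hdamp
  -- Second use of Barbalat, now on `v`; with `v → 0` it makes the whole vector field vanish in the
  -- limit.
  have hv' := tendsto_zero_of_uniformContinuousOn_deriv
    (fun t ht => (hx t ht).snd)
    ((hA.uniformContinuousOn_of_continuous hF.snd).comp hxu hxA) hv
  refine hA.tendsto_of_tendsto_comp hF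
    (fun y hy h => K.eq_zero_of_closedLoop_eq_zero (hAS hy) (hψ y hy) h) hev ?_
  have h := hv.prodMk_nhds hv'
  refine h.congr fun t => ?_
  simp only [closedLoop_eq]

/-- Take `m` to be the minimum of the energy on the part of `A` outside the ball, positive because
the energy vanishes only at the origin. -/
theorem exists_forall_norm_lt {A : Set (Vec n × Vec n)} (hA : IsCompact A)
    (hAS : A ⊆ S.stateSpace) {ε : ℝ} (hε : 0 < ε) :
    ∃ m > 0, ∀ y ∈ A, K.energy y < m → ‖y‖ < ε := by
  have hK' : IsCompact (A ∩ (Metric.ball 0 ε)ᶜ) := hA.inter_right Metric.isOpen_ball.isClosed_compl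
  have hnorm : ∀ y, y ∉ (Metric.ball (0 : Vec n × Vec n) ε)ᶜ → ‖y‖ < ε := fun y hy => by
    simpa using hy
  rcases (A ∩ (Metric.ball 0 ε)ᶜ).eq_empty_or_nonempty with he | hne
  · exact ⟨1, one_pos, fun y hy _ => hnorm y fun h =>
      (he ▸ (show y ∈ A ∩ (Metric.ball 0 ε)ᶜ from ⟨hy, h⟩) : y ∈ (∅ : Set (Vec n × Vec n)))⟩
  · obtain ⟨p, hp, hmin⟩ := hK'.exists_isMinOn hne
      (K.contDiffOn_energy.continuousOn.mono (inter_subset_left.trans hAS))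
    refine ⟨K.energy p, lt_of_le_of_ne (K.energy_nonneg (hAS hp.1)) fun h => hp.2 ?_,
      fun y hy hlt => hnorm y fun h => absurd (hmin ⟨hy, h⟩) (not_le.2 hlt)⟩
    rw [K.eq_zero_of_energy_eq_zero (hAS hp.1) h.symm]
    exact Metric.mem_ball_self hε

end SafetyDesign

theorem mainTheorem3 {n : ℕ} (S : MechanicalSystem n) (K : SafetyDesign S)
    (E : Set (Vec n × Vec n)) (hE_open : IsOpen E) (hE_state : E ⊆ S.stateSpace)
    (hE_safe : K.safeSet ⊆ E)
    (hreg : BarrierRegular K.h (S.lieInput K.h) K.safeSet E S.stateSpace)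
    (ν kc ρ : ℝ) (hν : 0 < ν) (hkc : 0 < kc)
    (hcompact : IsCompact (K.P ν ∩ K.Q))
    (hC : ∀ q ∈ K.P ν ∩ K.Q, ∀ v : Vec n, ‖S.C q v‖ ≤ kc * ‖v‖)
    (hψ : ∀ q ∈ K.P ν ∩ K.Q, 0 < K.ψ q)
    (hρ : IsGreatest (K.gainAt kc '' (K.P ν ∩ K.Q)) ρ) :
    -- safety: global solutions exist, every solution extends to one, none leaves the sets
    (∀ x₀ ∈ K.Γ ν ∩ K.safeSet,
      (∃ x : ℝ → Vec n × Vec n, SolvesOn S.stateSpace (K.closedLoop ρ) x (Ici 0) ∧ x 0 = x₀) ∧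
      (∀ (T : ℝ) (x : ℝ → Vec n × Vec n), 0 < T →
        SolvesOn S.stateSpace (K.closedLoop ρ) x (Ico 0 T) → x 0 = x₀ →
        ∃ y : ℝ → Vec n × Vec n,
          SolvesOn S.stateSpace (K.closedLoop ρ) y (Ici 0) ∧ EqOn x y (Ico 0 T)) ∧
      (∀ x : ℝ → Vec n × Vec n, SolvesOn S.stateSpace (K.closedLoop ρ) x (Ici 0) → x 0 = x₀ →
        ∀ t, 0 ≤ t → x t ∈ K.Γ ν ∩ K.safeSet ∧ (x t).1 ∈ K.P ν ∩ K.Q)) ∧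
    -- asymptotic stability, with `Γ_ν ∩ 𝒞` in the region of attraction
    (AsymptoticallyStableAtOrigin S.stateSpace (K.closedLoop ρ) ∧
      AttractedToOrigin S.stateSpace (K.closedLoop ρ) (K.Γ ν ∩ K.safeSet)) ∧
    -- passivity from `μ = -K_d v` to `v`, with storage function `V`
    (PassiveOnWithStorage S.stateSpace (K.Γ ν ∩ K.safeSet) (K.portedLoop ρ) Prod.snd K.energy ∧
      ∀ x ∈ K.Γ ν ∩ K.safeSet,
        K.closedLoop ρ x = K.portedLoop ρ x (-K.Kd x.2) ∧
        fderiv ℝ K.energy x (K.closedLoop ρ x) ≤ inner ℝ (-K.Kd x.2) x.2) := by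
  have hgain : ∀ q ∈ K.P ν ∩ K.Q, K.gainAt kc q ≤ ρ := fun q hq => hρ.2 (mem_image_of_mem _ hq)
  have hne : (K.P ν ∩ K.Q).Nonempty := hρ.nonempty.of_image
  set A := K.Γ ν ∩ K.safeSet with hA
  have hAS : A ⊆ S.stateSpace := fun y hy => hy.1.1
  have hAψ : ∀ y ∈ A, 0 < K.ψ y.1 := fun y hy => hψ _ (K.fst_mem_of_mem hy)
  have hAU : A ⊆ K.regularRegion := fun y hy => K.mem_regularRegion hE_safe hreg hy.2 (hAψ y hy)
  have hAc : IsCompact A := K.isCompact_inter_safeSet hcompact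
  have hinv := K.locallyForwardInvariant hkc.le hAU hC hψ hgain
  have hdiss : ∀ y ∈ A, fderiv ℝ K.energy y (K.closedLoop ρ y) ≤ -inner ℝ y.2 (K.Kd y.2) :=
    fun y hy => K.fderiv_energy_closedLoop_le hkc.le hC hψ hgain hy
  have hF := K.continuousOn_closedLoop ρ
  have hmem : ∀ x : ℝ → Vec n × Vec n, SolvesOn S.stateSpace (K.closedLoop ρ) x (Ici 0) →
      x 0 ∈ A → ∀ t, 0 ≤ t → x t ∈ A := fun x hx h0 t ht => hinv.mem_of_Ici hAc.isClosed hx.2 h0 ht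
  have hsolves : ∀ x : ℝ → Vec n × Vec n, x 0 ∈ A →
      IsIntegralCurveOn x (fun _ => K.closedLoop ρ) (Ici 0) →
      SolvesOn S.stateSpace (K.closedLoop ρ) x (Ici 0) := fun x h0 hx =>
    ⟨fun t ht => hAS (hinv.mem_of_Ici hAc.isClosed hx h0 ht), hx⟩
  have hex : ∀ x₀ ∈ A, ∃ x : ℝ → Vec n × Vec n,
      SolvesOn S.stateSpace (K.closedLoop ρ) x (Ici 0) ∧ x 0 = x₀ := by
    intro x₀ hx₀
    obtain ⟨x, h0, hx⟩ := hinv.exists_isIntegralCurveOn_Ici hAc K.isOpen_regularRegion hAU hF hx₀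
    exact ⟨x, hsolves x (h0 ▸ hx₀) hx, h0⟩
  have hattr : AttractedToOrigin S.stateSpace (K.closedLoop ρ) A := by
    refine fun x₀ hx₀ => ⟨hex x₀ hx₀, fun x hx h0 => ?_⟩
    exact K.tendsto_zero_of_isIntegralCurveOn hAc hAU hdiss hAψ hx.2
      (hmem x hx (h0 ▸ hx₀))
  have hzero := K.zero_mem_of_ψ_pos hcompact hne hψ
  have hAnhds : A ∈ 𝓝 (0 : Vec n × Vec n) := K.inter_safeSet_mem_nhds_zero hν hzero (hψ 0 hzero)
  refine ⟨fun x₀ hx₀ => ⟨hex x₀ hx₀, fun T x hT hx h0 => ?_, fun x hx h0 t ht => ?_⟩,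
    ⟨⟨?_, ?_, ?_, ?_⟩, hattr⟩, ⟨K.contDiffOn_energy, K.energy_zero,
      fun y hy => K.energy_nonneg (hAS hy), fun y hy μ => ?_⟩, fun y hy => ⟨?_, ?_⟩⟩
  · obtain ⟨y, hy, hxy⟩ := hinv.exists_extension hAc K.isOpen_regularRegion hAU hF hT hx.2
      (h0 ▸ hx₀)
    have hy0 : y 0 = x 0 := (hxy ⟨le_rfl, hT⟩).symm
    exact ⟨y, hsolves y (by rw [hy0, h0]; exact hx₀) hy, hxy⟩
  · have := hmem x hx (h0 ▸ hx₀) t ht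
    exact ⟨this, K.fst_mem_of_mem this⟩
  · exact mem_interior_iff_mem_nhds.2 (mem_of_superset hAnhds hAS)
  · exact K.closedLoop_zero hzero.1.1 (hψ 0 hzero)
  · intro ε hε
    obtain ⟨m, hm, hmε⟩ := K.exists_forall_norm_lt hAc hAS hε
    have hVc : ContinuousAt K.energy 0 := K.contDiffOn_energy.continuousOn.continuousAt
      (mem_of_superset hAnhds hAS)
    obtain ⟨δ, hδ, hball⟩ := Metric.eventually_nhds_iff_ball.1
      ((hVc.eventually_lt_const (show K.energy 0 < m by rwa [K.energy_zero])).and hAnhds)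
    -- The `δ`-ball lies inside `A` and below the energy level `m`; invariance and decay preserve
    -- both.
    refine ⟨δ, hδ, fun x T hT hx hx0 t ht => ?_⟩
    obtain ⟨h1, h2⟩ := hball (x 0) (by simpa using hx0)
    have hxA : ∀ s ∈ Ico 0 T, x s ∈ A := fun s hs => hinv.mem hAc.isClosed hx.2 h2 hs
    have hanti := K.antitoneOn_energy_comp hAS (fun y hy => (hdiss y hy).trans
      (neg_nonpos.2 (K.Kd_posDef.inner_nonneg _))) (convex_Ico 0 T) hx.2 hxA
    exact hmε _ (hxA t ht) ((hanti ⟨le_rfl, hT⟩ ht ht.1).trans_lt h1)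
  · obtain ⟨δ, hδ, hball⟩ := Metric.mem_nhds_iff.1 hAnhds
    exact ⟨δ, hδ, fun x₀ hx₀ => hattr x₀ (hball hx₀)⟩
  · have hq := K.fst_mem_of_mem hy
    have := K.inner_augControl_sub_nominal_nonpos (hAS hy) hkc.le (hC _ hq _) (hψ _ hq)
      (hgain _ hq)
    rw [K.fderiv_energy_portedLoop ρ (hAS hy)]
    linarith
  · exact K.closedLoop_eq_portedLoop ρ y
  · rw [inner_neg_left, real_inner_comm]
    exact hdiss y hy
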